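/- All graphs are finite and simple, and $|G|$ is the number of vertices of $G$. An outerplane graph is a planar embedding of a graph such that all vertices lie on the boundary of the outer face. The size of a face is the number of edges on its boundary, cut edges being counted twice; a $k^-$-face is a face of size at most $k-1$. For edges $e,e'$ of an outerplane graph $G$ write $e\sim_k e'$ if $e=e'$ or there is a sequence $e=e_0,F_1,e_1,F_2,\dots,F_l,e_l=e'$ of edges $e_i$ and inner $k^-$-faces $F_i$ of $G$ such that $e_{i-1}$ and $e_i$ are both incident with $F_i$ for $1\le i\le l$. This is an equivalence relation on $E(G)$; the subgraphs formed by the edges of one equivalence class (and their endpoints) are the $k$-blocks of $G$, and they decompose $G$. A trivial $k$-block is a graph that is either isomorphic to $K_2$ or a 2-connected outerplane graph (in particular with at least three vertices) each of whose inner faces is a $k^-$-face. A graph is $C_k$-free if it has no subgraph isomorphic to the cycle $C_k$ on $k$ vertices. **Lemma.** Let $t\ge 1$ and $k\ge 3$ be integers, and let $B_1,\dots,B_t$ be $C_k$-free trivial $k$-blocks. Let $\mathscr{B}_k(B_1,\dots,B_t)$ be the set of connected $C_k$-free outerplane graphs that have exactly $t$ $k$-blocks, these being isomorphic to $B_1,\dots,B_t$,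 respectively. Then $\mathscr{B}_k(B_1,\dots,B_t)$ is non-empty and $$\min\{|G| : G\in \mathscr{B}_k(B_1,\dots,B_t)\}=\sum_{i=1}^{t}|B_i|-\Big\lfloor\frac{t-1}{k}\Big\rfloor-t+1 .$$ -/

import Mathlib

/-- A rotation system on a simple graph `G`: for every vertex a cyclic order on the darts
(oriented edges) leaving it. `rot` sends a dart to the next one in the order around its source. -/
structure RotationSystem {V : Type*} (G : SimpleGraph V) where
  rot : Equiv.Perm G.Dart
  rot_fst : ∀ d, (rot d).fst = d.fst
  rot_cyclic : ∀ d d' : G.Dart, d.fst = d'.fst → rot.SameCycle d d'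

namespace RotationSystem

variable {V : Type*} {G : SimpleGraph V}

/-- The face permutation: after the dart `d = (u, v)`, the boundary walk of the face continues
with the dart that follows `(v, u)` in the rotation at `v`. -/
def facePerm (E : RotationSystem G) : Equiv.Perm G.Dart :=
  E.rot * ⟨SimpleGraph.Dart.symm, SimpleGraph.Dart.symm,
    SimpleGraph.Dart.symm_symm, SimpleGraph.Dart.symm_symm⟩

/-- A face is an orbit of the face permutation, i.e. a closed boundary walk. -/
def Face (E : RotationSystem G) : Type _ :=
  Quotient (Equiv.Perm.SameCycle.setoid E.facePerm)

/-- The face whose boundary walk traverses the dart `d`. -/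
def faceOf (E : RotationSystem G) (d : G.Dart) : E.Face :=
  Quotient.mk (Equiv.Perm.SameCycle.setoid E.facePerm) d

/-- The size of a face: the length of its boundary walk, so that cut edges count twice. -/
noncomputable def faceSize (E : RotationSystem G) (F : E.Face) : ℕ :=
  Nat.card {d : G.Dart // E.faceOf d = F}

/-- The vertex `v` lies on the boundary of the face `F`. -/
def VertexOn (E : RotationSystem G) (v : V) (F : E.Face) : Prop :=
  ∃ d : G.Dart, E.faceOf d = F ∧ d.fst = v

/-- The edge `e` is incident with the face `F`. -/
def EdgeOn (E : RotationSystem G) (e : Sym2 V) (F : E.Face) : Prop :=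
  ∃ d : G.Dart, E.faceOf d = F ∧ d.edge = e

end RotationSystem

/-- An embedding in the sphere of a finite connected graph with at least one edge, given
combinatorially, i.e. up to orientation-preserving homeomorphism, by a rotation system of genus
zero: Euler's formula `|V| - |E| + |F| = 2` holds. (The one-vertex graph, which has no edge and
hence no dart, has no such structure.) -/
structure SphereEmbedding {V : Type*} [Fintype V] (G : SimpleGraph V)
    extends RotationSystem G where
  connected : G.Connected
  euler : Fintype.card V + Nat.card toRotationSystem.Face = Nat.card G.edgeSet + 2

/-- An outerplane graph structure on a finite connected graph with at least one edge: a planar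
embedding, i.e. an embedding in the sphere with a distinguished outer face, such that every
vertex lies on the boundary of the outer face. -/
structure OuterplaneEmbedding {V : Type*} [Fintype V] (G : SimpleGraph V)
    extends SphereEmbedding G where
  outer : toRotationSystem.Face
  vertexOn_outer : ∀ v : V, toRotationSystem.VertexOn v outer

namespace OuterplaneEmbedding

variable {V : Type*} [Fintype V] {G : SimpleGraph V}

/-- `F` is an inner face of size at most `k - 1`. -/
def IsSmallInnerFace (E : OuterplaneEmbedding G) (k : ℕ) (F : E.Face) : Prop :=
  F ≠ E.outer ∧ E.faceSize F < k

/-- `k`-face-connectedness of edges: `e = e'`, or there is a finite sequence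
`e F₁ e₁ F₂ … F_l e'` of edges and inner faces of size at most `k - 1` in which
consecutive edges are both incident with the face between them. -/
def FaceConnected (E : OuterplaneEmbedding G) (k : ℕ) : G.edgeSet → G.edgeSet → Prop :=
  Relation.ReflTransGen fun e e' =>
    ∃ F : E.Face, E.IsSmallInnerFace k F ∧ E.EdgeOn e F ∧ E.EdgeOn e' F

/-- The `k`-block `G(k, e)`: the subgraph formed by the edges that are `k`-face-connected
to `e` and their endpoints. -/
def kBlock (E : OuterplaneEmbedding G) (k : ℕ) (e : G.edgeSet) : G.Subgraph where
  verts := {v | ∃ e' : G.edgeSet, E.FaceConnected k e e' ∧ v ∈ (e' : Sym2 V)}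
  Adj v w := ∃ e' : G.edgeSet, E.FaceConnected k e e' ∧ (e' : Sym2 V) = s(v, w)
  adj_sub := by
    rintro v w ⟨⟨_, h⟩, -, rfl⟩
    exact h
  edge_vert := by
    rintro v w ⟨e', h, he⟩
    exact ⟨e', h, he ▸ Sym2.mem_mk_left v w⟩
  symm := ⟨by
    rintro v w ⟨e', h, he⟩
    exact ⟨e', h, he.trans Sym2.eq_swap⟩⟩

/-- The set of all `k`-blocks of an outerplane graph. -/
def kBlocks (E : OuterplaneEmbedding G) (k : ℕ) : Set G.Subgraph :=
  Set.range (E.kBlock k)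

end OuterplaneEmbedding

/-- A graph is 2-connected if it has at least three vertices, is connected, and stays
connected when any one vertex is deleted. -/
def IsTwoConnected {V : Type*} [Fintype V] (G : SimpleGraph V) : Prop :=
  3 ≤ Fintype.card V ∧ G.Connected ∧ ∀ v : V, (G.induce {v}ᶜ).Connected

/-- A trivial `k`-block: `K₂`, or a 2-connected outerplane graph all of whose inner faces have
size at most `k - 1`. -/
def IsTrivialKBlock {V : Type*} [Fintype V] (k : ℕ) (G : SimpleGraph V) : Prop :=
  Nonempty (G ≃g (⊤ : SimpleGraph (Fin 2))) ∨
    (IsTwoConnected G ∧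
      ∃ E : OuterplaneEmbedding G, ∀ F : E.Face, F ≠ E.outer → E.faceSize F < k)

/-- `G` belongs to the family `𝓑_k(B₁, …, B_t)`: it is a connected `C_k`-free outerplane graph
(for some embedding) that has exactly `t` `k`-blocks, isomorphic to `B₁, …, B_t` respectively. -/
def MemBlockFamily {W : Type*} [Fintype W] (G : SimpleGraph W) (k t : ℕ) {V : Fin t → Type*}
    (B : ∀ i, SimpleGraph (V i)) : Prop :=
  G.Connected ∧ (SimpleGraph.cycleGraph k).Free G ∧
    ∃ E : OuterplaneEmbedding G, ∃ f : Fin t ≃ E.kBlocks k,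
      ∀ i, Nonempty (B i ≃g (f i : G.Subgraph).coe)

/-! Both bounds rest on a linear-algebra form of Euler's inequality. Inside the functions on darts,
coboundaries of vertex functions, boundaries of face functions and reversal-symmetric functions are
independent, so a dimension count bounds vertices plus faces. In the case of equality every
circulation is the boundary of a face potential, which replaces the Jordan curve theorem.

Lower bound (`sum_card_verts_le`). Let q be the number of inner faces of size at least k. An inner
face of an outerplane graph is bounded by a cycle (`dart_eq_of_inner`), so in a C_k-free graph these
faces have size at least k + 1. Euler's inequality for the disjoint union of the k-blocks, together
with Euler's formula for G, gives Σ|B_i| ≤ |G| + t - 1 + q. Double counting of face sizes, where the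
outer face has size at least |G| and the small faces have total size at least |E| + #small - t,
gives q(k + 1) ≤ q + t - 1. Hence q ≤ ⌊(t-1)/k⌋.

Upper bound (`exists_memBlockFamily`). With s = ⌊(t-1)/k⌋, the blocks are glued at corners of their
outer faces into s rings of k + 1 blocks. All rings share a hub vertex, consecutive rings share a
block, and the remaining blocks hang at the hub. Connecting the blocks saves t - 1 vertices and
closing the rings saves s more. The count meets Euler's inequality with equality, so the glued map
is planar. A potential that is nonzero on a ring must jump across more than k blocks. A circulation
using at most k blocks therefore has zero potential on every ring and splits into circulations of
the single blocks (`sum_mul_pt_eq_zero`). This shows that blocks embed injectively, that the glued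
graph is simple, and that each of its k-cycles lies in one block. -/

/-! ### Euler's inequality by linear algebra on darts. -/

open Finset in
-- The pairing telescopes along every face walk. The label `none` carries potential 0, so incidence
-- of `φ` with `p` is needed only off `none`; later, all faces of no interest can be merged into
-- `none`.
theorem sum_coboundary_mul_boundary_eq_zero {D X S : Type*} [Fintype D]
    {σ : D → D} {φ : Equiv.Perm D} {p : D → X} {L : D → Option S}
    (hσ : Function.Involutive σ) (hL : ∀ d, L (φ d) = L d)
    (hp : ∀ d, L d ≠ none → p (φ d) = p (σ d)) (f : X → ℚ) (g : Option S → ℚ) (hg : g none = 0) :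
    ∑ d, (f (p (σ d)) - f (p d)) * (g (L d) - g (L (σ d))) = 0 := by
  have key : ∑ d, f (p (σ d)) * g (L d) = ∑ d, f (p d) * g (L d) := by
    rw [← Equiv.sum_comp φ (fun d => f (p d) * g (L d))]
    refine sum_congr rfl fun d _ => ?_
    rw [hL]
    by_cases h : L d = none
    · rw [h, hg, mul_zero, mul_zero]
    · rw [hp d h]
  have h1 : ∑ d, (f (p (σ d)) - f (p d)) * g (L (σ d))
      = ∑ d, (f (p d) - f (p (σ d))) * g (L d) := by
    rw [← Equiv.sum_comp hσ.toPerm (fun d => (f (p d) - f (p (σ d))) * g (L d))]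
    refine sum_congr rfl fun d _ => ?_
    simp [hσ d]
  simp only [mul_sub, sum_sub_distrib, h1]
  simp only [sub_mul, sum_sub_distrib, key]
  ring

/-- The linear map behind the Euler inequality: coboundaries of vertex functions, boundaries of
face functions and symmetric functions inside the space of functions on darts. -/
def eulerMap {D X S E T : Type*} (σ : D → D) (p : D → X) (L : D → Option S) (edge : D → E)
    (r : T → X) : ((X → ℚ) × (S → ℚ) × (E → ℚ)) →ₗ[ℚ] (T → ℚ) × (D → ℚ) where
  toFun a := (fun t => a.1 (r t), fun d => (a.1 (p (σ d)) - a.1 (p d)) +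
    ((L d).elim 0 a.2.1 - (L (σ d)).elim 0 a.2.1) + a.2.2 (edge d))
  map_add' a b := by
    ext d
    · simp
    · cases h1 : L d <;> cases h2 : L (σ d) <;> simp [h1, h2] <;> ring
  map_smul' c a := by
    ext d
    · simp
    · cases h1 : L d <;> cases h2 : L (σ d) <;> simp [h1, h2] <;> ring

open Finset in
-- Coboundaries and boundaries are antisymmetric under `σ` and the third summand is symmetric, so
-- the latter vanishes. Orthogonality then kills the other two. `hS` and `hX` express connectedness
-- of the dual and of the graph, normalised at `none` and at the base points `r t`.
theorem eulerMap_injective {D X S E T : Type*} [Fintype D]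
    {σ : D → D} {φ : Equiv.Perm D} {p : D → X} {L : D → Option S} {edge : D → E} {r : T → X}
    (hσ : Function.Involutive σ) (hL : ∀ d, L (φ d) = L d)
    (hp : ∀ d, L d ≠ none → p (φ d) = p (σ d))
    (hedge : Function.Surjective edge) (hedgeσ : ∀ d, edge (σ d) = edge d)
    (hS : ∀ g : Option S → ℚ, g none = 0 → (∀ d, g (L (σ d)) = g (L d)) → ∀ s, g s = 0)
    (hX : ∀ f : X → ℚ, (∀ d, f (p (σ d)) = f (p d)) → (∀ t, f (r t) = 0) → ∀ x, f x = 0) :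
    Function.Injective (eulerMap σ p L edge r) := by
  rw [injective_iff_map_eq_zero]
  rintro ⟨f, g, h⟩ h0
  have hr : ∀ t, f (r t) = 0 := fun t => congr_fun (congr_arg Prod.fst h0) t
  have hd : ∀ d, (f (p (σ d)) - f (p d)) + ((L d).elim 0 g - (L (σ d)).elim 0 g) + h (edge d) = 0 :=
    fun d => congr_fun (congr_arg Prod.snd h0) d
  have hh : ∀ d, h (edge d) = 0 := by
    intro d
    have h1 := hd d
    have h2 := hd (σ d)
    rw [hσ d, hedgeσ] at h2
    linarith
  have orth := sum_coboundary_mul_boundary_eq_zero hσ hL hp f (fun o => o.elim 0 g) rfl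
  have hB : ∀ d, (L d).elim 0 g - (L (σ d)).elim 0 g = 0 := by
    have : ∑ d, ((L d).elim 0 g - (L (σ d)).elim 0 g) ^ 2 = 0 := by
      refine (sum_congr rfl fun d _ => ?_).trans ((sum_neg_distrib _).trans (neg_eq_zero.2 orth))
      have := hd d
      rw [hh, add_zero] at this
      rw [eq_neg_of_add_eq_zero_left this]
      ring
    rw [sum_eq_zero_iff_of_nonneg fun d _ => sq_nonneg _] at this
    exact fun d => pow_eq_zero_iff two_ne_zero |>.1 (this d (mem_univ d))
  have hg : g = 0 := by
    ext s
    exact hS (fun o => o.elim 0 g) rfl (fun d => by linarith [hB d]) (some s)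
  have hf : f = 0 := by
    ext x
    refine hX f (fun d => ?_) hr x
    have := hd d
    rw [hh, hB] at this
    linarith
  have hh' : h = 0 := by
    ext e
    obtain ⟨d, rfl⟩ := hedge e
    exact hh d
  rw [hf, hg, hh']
  rfl

theorem card_vertex_add_card_face_add_card_edge_le {D X S E T : Type*}
    [Finite D] [Finite X] [Finite S] [Finite E] [Finite T]
    {σ : D → D} {φ : Equiv.Perm D} {p : D → X} {L : D → Option S} {edge : D → E} {r : T → X}
    (hσ : Function.Involutive σ) (hL : ∀ d, L (φ d) = L d)
    (hp : ∀ d, L d ≠ none → p (φ d) = p (σ d))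
    (hedge : Function.Surjective edge) (hedgeσ : ∀ d, edge (σ d) = edge d)
    (hS : ∀ g : Option S → ℚ, g none = 0 → (∀ d, g (L (σ d)) = g (L d)) → ∀ s, g s = 0)
    (hX : ∀ f : X → ℚ, (∀ d, f (p (σ d)) = f (p d)) → (∀ t, f (r t) = 0) → ∀ x, f x = 0) :
    Nat.card X + Nat.card S + Nat.card E ≤ Nat.card T + Nat.card D := by
  cases nonempty_fintype D
  cases nonempty_fintype X
  cases nonempty_fintype S
  cases nonempty_fintype E
  cases nonempty_fintype T
  have := LinearMap.finrank_le_finrank_of_injective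
    (eulerMap_injective hσ hL hp hedge hedgeσ hS hX)
  simpa [Module.finrank_prod, Module.finrank_fintype_fun_eq_card, add_assoc] using this

open Finset in
/-- In the case of equality, every circulation is the boundary of a function on the faces. -/
theorem exists_boundary_eq_of_card_eq {D X S E T : Type*}
    [Fintype D] [Finite X] [Finite S] [Finite E] [Finite T]
    {σ : D → D} {φ : Equiv.Perm D} {p : D → X} {L : D → Option S} {edge : D → E} {r : T → X}
    (hσ : Function.Involutive σ) (hL : ∀ d, L (φ d) = L d)
    (hp : ∀ d, L d ≠ none → p (φ d) = p (σ d))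
    (hedge : Function.Surjective edge) (hedgeσ : ∀ d, edge (σ d) = edge d)
    (hS : ∀ g : Option S → ℚ, g none = 0 → (∀ d, g (L (σ d)) = g (L d)) → ∀ s, g s = 0)
    (hX : ∀ f : X → ℚ, (∀ d, f (p (σ d)) = f (p d)) → (∀ t, f (r t) = 0) → ∀ x, f x = 0)
    (hcard : Nat.card X + Nat.card S + Nat.card E = Nat.card T + Nat.card D)
    (c : D → ℚ) (hc : ∀ d, c (σ d) = -c d) (hdiv : ∀ f : X → ℚ, ∑ d, c d * f (p d) = 0) :
    ∃ g : Option S → ℚ, g none = 0 ∧ ∀ d, c d = g (L d) - g (L (σ d)) := by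
  cases nonempty_fintype X
  cases nonempty_fintype S
  cases nonempty_fintype E
  cases nonempty_fintype T
  -- Equal dimensions turn injectivity into surjectivity, so `c` decomposes as coboundary plus
  -- boundary plus symmetric part; the symmetric part vanishes because `c` is antisymmetric.
  have hsurj : Function.Surjective (eulerMap σ p L edge r) := by
    rw [← LinearMap.injective_iff_surjective_of_finrank_eq_finrank]
    · exact eulerMap_injective hσ hL hp hedge hedgeσ hS hX
    · simpa [Module.finrank_prod, Module.finrank_fintype_fun_eq_card, add_assoc] using hcard
  obtain ⟨⟨f, g, h⟩, h0⟩ := hsurj (0, c)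
  have hd : ∀ d, (f (p (σ d)) - f (p d)) + ((L d).elim 0 g - (L (σ d)).elim 0 g) + h (edge d)
      = c d := fun d => congr_fun (congr_arg Prod.snd h0) d
  have hh : ∀ d, h (edge d) = 0 := by
    intro d
    have h1 := hd d
    have h2 := hd (σ d)
    rw [hσ d, hedgeσ] at h2
    linarith [hc d]
  have orth := sum_coboundary_mul_boundary_eq_zero hσ hL hp f (fun o => o.elim 0 g) rfl
  have orth' : ∑ d, (f (p (σ d)) - f (p d)) * c d = 0 := by
    have h1 : ∑ d, f (p (σ d)) * c d = - ∑ d, c d * f (p d) := by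
      rw [← Equiv.sum_comp hσ.toPerm (fun d => c d * f (p d)), ← sum_neg_distrib]
      refine sum_congr rfl fun d _ => ?_
      simp only [Function.Involutive.coe_toPerm, hc]
      ring
    have h2 : ∑ d, f (p d) * c d = ∑ d, c d * f (p d) := sum_congr rfl fun d _ => mul_comm _ _
    simp only [sub_mul, sum_sub_distrib, h1, h2, hdiv f]
    simp
  -- The coboundary part is orthogonal to `c` by `hdiv` and to every boundary, hence to itself.
  have hA : ∀ d, f (p (σ d)) - f (p d) = 0 := by
    have : ∑ d, (f (p (σ d)) - f (p d)) ^ 2 = 0 := by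
      refine (sum_congr rfl fun d _ => ?_).trans
        ((sum_sub_distrib _ _).trans (sub_eq_zero.2 (orth'.trans orth.symm)))
      have := hd d
      rw [hh, add_zero] at this
      rw [← this]
      ring
    rw [sum_eq_zero_iff_of_nonneg fun d _ => sq_nonneg _] at this
    exact fun d => pow_eq_zero_iff two_ne_zero |>.1 (this d (mem_univ d))
  refine ⟨fun o => o.elim 0 g, rfl, fun d => ?_⟩
  rw [← hd d, hh, hA]
  simp

/-! ### Permutations: invariant functions, splitting a cycle, extending partial injections. -/

theorem Equiv.apply_swap_eq {D Y : Type*} [DecidableEq D] {f : D → Y} {a b : D} (h : f a = f b)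
    (d : D) : f (swap a b d) = f d := by
  rw [swap_apply_def]
  split_ifs with ha hb
  · rw [ha, h]
  · rw [hb, h]
  · rfl

namespace Equiv.Perm

/-- A function that may change only when entering a set meeting every cycle at most once does not
change at all. -/
theorem apply_eq_of_forall_not_mem {D Y : Type*} [Finite D] {ρ : Perm D} {O : Set D} {F : D → Y}
    (hO : ∀ d ∈ O, ∀ d' ∈ O, ρ.SameCycle d d' → d = d') (hF : ∀ d, ρ d ∉ O → F (ρ d) = F d)
    (d : D) : F (ρ d) = F d := by
  by_cases ho : ρ d ∈ O
  swap
  · exact hF d ho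
  -- Walking on from `ρ d`, the only point of `O` that can be met is `ρ d` itself, so the value
  -- cannot change before the walk closes up.
  have key : ∀ i : ℕ, F ((ρ ^ i) (ρ d)) = F (ρ d) := by
    intro i
    induction i with
    | zero => rfl
    | succ i ih =>
      rw [pow_succ', mul_apply]
      by_cases h : ρ ((ρ ^ i) (ρ d)) ∈ O
      · rw [← hO _ ho _ h ⟨(i + 1 : ℕ), by rw [zpow_natCast, pow_succ', mul_apply]⟩]
      · rw [hF _ h, ih]
  obtain ⟨i, hi⟩ := (SameCycle.symm ⟨1, by simp⟩ : ρ.SameCycle (ρ d) d).exists_nat_pow_eq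
  rw [← key i, hi]

/-- A transposition of two points of one cycle splits that cycle: from `a` the new permutation
follows `ρ` and jumps back to `a` exactly when it would reach `b`. This is how a face or a vertex is
cut in two below. -/
theorem not_sameCycle_swap_mul {D : Type*} [Finite D] [DecidableEq D] {ρ : Perm D} {a b : D}
    (hab : a ≠ b) (h : ρ.SameCycle a b) : ¬ (swap a b * ρ).SameCycle a b := by
  classical
  have hex : ∃ n : ℕ, (ρ ^ n) a = b := h.exists_nat_pow_eq
  set n := Nat.find hex with hn
  have hnb : (ρ ^ n) a = b := Nat.find_spec hex
  have hlt : ∀ i < n, (ρ ^ i) a ≠ b := fun i hi => Nat.find_min hex hi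
  have hn0 : n ≠ 0 := by
    intro h0
    rw [h0] at hnb
    exact hab hnb
  have hna : ∀ i, 0 < i → i < n → (ρ ^ i) a ≠ a := by
    intro i hi hin hia
    refine hlt (n - i) (by omega) ?_
    rw [← hnb]
    nth_rewrite 1 [← hia]
    rw [← mul_apply, ← pow_add]
    congr 2
    omega
  have key : ∀ j : ℕ, ∃ i < n, ((swap a b * ρ) ^ j) a = (ρ ^ i) a := by
    intro j
    induction j with
    | zero => exact ⟨0, by omega, rfl⟩
    | succ j ih =>
      obtain ⟨i, hi, hj⟩ := ih
      rw [pow_succ', mul_apply, hj, mul_apply, ← mul_apply ρ, ← pow_succ']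
      by_cases h1 : i + 1 = n
      · exact ⟨0, by omega, by rw [h1, hnb, swap_apply_right]; rfl⟩
      · exact ⟨i + 1, by omega,
          swap_apply_of_ne_of_ne (hna _ (by omega) (by omega)) (hlt _ (by omega))⟩
  intro hs
  obtain ⟨j, hj⟩ := hs.exists_nat_pow_eq
  obtain ⟨i, hi, hj'⟩ := key j
  exact hlt i hi (hj' ▸ hj)

/-- A partial injection extends to a permutation moving points only inside the classes it
generates. -/
theorem exists_extend {D ι : Type*} [Fintype ι] {u v : ι → D} (hu : Function.Injective u)
    (hv : Function.Injective v) :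
    ∃ π : Perm D, (∀ i, π (u i) = v i) ∧
      ∀ P : D → Prop, (∀ i, P (u i) ↔ P (v i)) → ∀ d, P (π d) ↔ P d := by
  classical
  suffices H : ∀ A : Finset ι, ∃ π : Perm D, (∀ i ∈ A, π (u i) = v i) ∧
      ∀ P : D → Prop, (∀ i, P (u i) ↔ P (v i)) → ∀ d, P (π d) ↔ P d by
    obtain ⟨π, h1, h2⟩ := H Finset.univ
    exact ⟨π, fun i => h1 i (Finset.mem_univ i), h2⟩
  intro A
  induction A using Finset.induction_on with
  | empty => exact ⟨1, by simp, fun P _ d => Iff.rfl⟩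
  | insert i A hi ih =>
    obtain ⟨π, h1, h2⟩ := ih
    -- `π (u i)` and `v i` lie in one class, so the correction stays inside it; injectivity of `u`
    -- and `v` protects the values already prescribed.
    refine ⟨swap (π (u i)) (v i) * π, fun j hj => ?_, fun P hP d => ?_⟩
    · rcases Finset.mem_insert.1 hj with rfl | hj
      · simp
      · have hji : j ≠ i := fun h => hi (h ▸ hj)
        rw [mul_apply, swap_apply_of_ne_of_ne, h1 j hj]
        · exact fun h => hji (hu (π.injective h))
        · rw [h1 j hj]
          exact fun h => hji (hv h)
    · rw [mul_apply, ← h2 P hP d]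
      have h3 : P (π (u i)) ↔ P (v i) := (h2 P hP _).trans (hP i)
      by_cases ha : π d = π (u i)
      · rw [ha, swap_apply_left, h3]
      · by_cases hb : π d = v i
        · rw [hb, swap_apply_right, h3]
        · rw [swap_apply_of_ne_of_ne ha hb]

end Equiv.Perm

theorem Equiv.Perm.SameCycle.apply_eq {D Y : Type*} {ρ : Equiv.Perm D} {F : D → Y}
    (hF : ∀ d, F (ρ d) = F d) {d d' : D} (h : ρ.SameCycle d d') : F d = F d' := by
  obtain ⟨i, rfl⟩ := h
  induction i using Int.induction_on with
  | zero => rfl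
  | succ i ih => rw [add_comm, zpow_add, Equiv.Perm.mul_apply, zpow_one, hF, ih]
  | pred i ih =>
    rw [ih, ← hF ((ρ ^ (-(i : ℤ) - 1)) d), ← Equiv.Perm.mul_apply, ← zpow_one_add]
    congr 3
    ring

/-! ### Darts of a graph and Euler's inequality for rotation systems. -/

namespace SimpleGraph

variable {V : Type*} {G : SimpleGraph V}

instance finite_dart [Finite V] : Finite G.Dart :=
  Finite.of_injective _ Dart.toProd_injective

theorem natCard_dart [Finite V] : Nat.card G.Dart = 2 * Nat.card G.edgeSet := by
  classical
  cases nonempty_fintype V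
  rw [Nat.card_eq_fintype_card, G.dart_card_eq_twice_card_edges, Nat.card_eq_fintype_card,
    edgeFinset_card]

/-- The edge underlying a dart, as an element of the edge set. -/
def Dart.toEdge (d : G.Dart) : G.edgeSet := ⟨d.edge, d.edge_mem⟩

theorem Dart.toEdge_symm (d : G.Dart) : d.symm.toEdge = d.toEdge :=
  Subtype.ext d.edge_symm

theorem Dart.toEdge_surjective : Function.Surjective (Dart.toEdge : G.Dart → G.edgeSet) := by
  rintro ⟨e, he⟩
  induction e with
  | h u v => exact ⟨⟨(u, v), he⟩, rfl⟩

theorem Dart.toEdge_eq_iff {d d' : G.Dart} : d.toEdge = d'.toEdge ↔ d = d' ∨ d = d'.symm := by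
  rw [← dart_edge_eq_iff, Dart.toEdge, Dart.toEdge, Subtype.mk.injEq]

theorem Dart.apply_eq_of_toEdge_eq {Y : Type*} {F : G.Dart → Y} (hF : ∀ d, F d.symm = F d)
    {d d' : G.Dart} (h : d.toEdge = d'.toEdge) : F d = F d' := by
  rcases Dart.toEdge_eq_iff.1 h with rfl | rfl
  · rfl
  · exact hF d'

theorem Preconnected.apply_eq {Y : Type*} (hG : G.Preconnected) {f : V → Y}
    (hf : ∀ u v, G.Adj u v → f u = f v) (u v : V) : f u = f v := by
  obtain ⟨p⟩ := hG u v
  induction p with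
  | nil => rfl
  | cons h _ ih => rw [hf _ _ h, ih]

theorem Preconnected.exists_dart_fst [Nontrivial V] (hG : G.Preconnected) (v : V) :
    ∃ d : G.Dart, d.fst = v := by
  obtain ⟨w, hw⟩ := hG.exists_adj_of_nontrivial v
  exact ⟨⟨(v, w), hw⟩, rfl⟩

theorem card_add_card_le_add_card_edgeSet [Finite V] {X S T : Type*} [Finite X] [Finite S]
    [Finite T] {φ : Equiv.Perm G.Dart} {p : G.Dart → X} {L : G.Dart → Option S} {r : T → X}
    (hL : ∀ d, L (φ d) = L d) (hp : ∀ d, L d ≠ none → p (φ d) = p d.symm)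
    (hS : ∀ g : Option S → ℚ, g none = 0 → (∀ d : G.Dart, g (L d.symm) = g (L d)) → ∀ s, g s = 0)
    (hX : ∀ f : X → ℚ, (∀ d : G.Dart, f (p d.symm) = f (p d)) → (∀ t, f (r t) = 0) →
      ∀ x, f x = 0) :
    Nat.card X + Nat.card S ≤ Nat.card T + Nat.card G.edgeSet := by
  have := card_vertex_add_card_face_add_card_edge_le (σ := Dart.symm) (φ := φ) (p := p) (L := L)
    (edge := Dart.toEdge) (r := r) Dart.symm_symm hL hp Dart.toEdge_surjective Dart.toEdge_symm
    hS hX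
  rw [natCard_dart] at this
  omega

end SimpleGraph

namespace RotationSystem

variable {V : Type*} {G : SimpleGraph V} (E : RotationSystem G)

theorem facePerm_apply (d : G.Dart) : E.facePerm d = E.rot d.symm := rfl

theorem facePerm_symm_apply (d : G.Dart) : E.facePerm d.symm = E.rot d := by
  rw [facePerm_apply, SimpleGraph.Dart.symm_symm]

theorem facePerm_fst (d : G.Dart) : (E.facePerm d).fst = d.snd := E.rot_fst d.symm

theorem faceOf_eq_iff {d d' : G.Dart} : E.faceOf d = E.faceOf d' ↔ E.facePerm.SameCycle d d' :=
  Quotient.eq (r := Equiv.Perm.SameCycle.setoid E.facePerm)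

theorem faceOf_facePerm (d : G.Dart) : E.faceOf (E.facePerm d) = E.faceOf d :=
  (E.faceOf_eq_iff).2 (Equiv.Perm.SameCycle.symm ⟨1, by simp⟩)

theorem faceOf_surjective : Function.Surjective E.faceOf := Quotient.mk_surjective

instance [Finite V] : Finite E.Face := Finite.of_surjective _ E.faceOf_surjective

variable {E}

theorem apply_eq_of_fst_eq {Y : Type*} {F : G.Dart → Y} (hF : ∀ d, F (E.rot d) = F d)
    {d d' : G.Dart} (h : d.fst = d'.fst) : F d = F d' :=
  (E.rot_cyclic d d' h).apply_eq hF

theorem apply_eq_of_preconnected {Y : Type*} (hG : G.Preconnected) {F : G.Dart → Y}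
    (hF : ∀ d, F (E.rot d) = F d) (hF' : ∀ d, F d.symm = F d) (d d' : G.Dart) : F d = F d' := by
  have key : ∀ u v, G.Reachable u v → ∀ d d' : G.Dart, d.fst = u → d'.fst = v → F d = F d' := by
    rintro u v ⟨p⟩
    induction p with
    | nil => exact fun d d' h h' => apply_eq_of_fst_eq hF (h.trans h'.symm)
    | @cons u v w h p ih =>
      intro d d' hd hd'
      rw [← ih (⟨(u, v), h⟩ : G.Dart).symm d' rfl hd', hF']
      exact apply_eq_of_fst_eq hF hd
  exact key _ _ (hG _ _) d d' rfl rfl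

/-- Euler's inequality for a rotation system on a connected graph. -/
theorem card_add_card_face_le [Finite V] (hG : G.Connected) (d₀ : G.Dart) :
    Nat.card V + Nat.card E.Face ≤ Nat.card G.edgeSet + 2 := by
  classical
  let L : G.Dart → Option {F : E.Face // F ≠ E.faceOf d₀} := fun d =>
    if h : E.faceOf d = E.faceOf d₀ then none else some ⟨E.faceOf d, h⟩
  have hLφ : ∀ d, L (E.facePerm d) = L d := by
    intro d
    simp only [L, faceOf_facePerm]
  have hL0 : L d₀ = none := dif_pos rfl
  have key := G.card_add_card_le_add_card_edgeSet (φ := E.facePerm) (p := fun d => d.fst) (L := L)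
    (r := fun _ : Unit => d₀.fst) hLφ (fun d _ => E.facePerm_fst d) (fun g hg hσ s => ?_)
    (fun f hf h0 x => ?_)
  · have : Nat.card {F : E.Face // F ≠ E.faceOf d₀} + 1 = Nat.card E.Face := by
      have := Finite.card_option (α := {F : E.Face // F ≠ E.faceOf d₀})
      rw [← this]
      exact Nat.card_congr (Equiv.optionSubtypeNe (E.faceOf d₀))
    simp only [Nat.card_unique] at key
    omega
  · have hconst : ∀ d, g (L d) = 0 := by
      intro d
      rw [← hg, ← hL0]
      refine apply_eq_of_preconnected hG.preconnected (E := E) (F := fun d => g (L d))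
        (fun d => ?_) hσ d d₀
      rw [← facePerm_symm_apply, hLφ, hσ]
    cases s with
    | none => exact hg
    | some F =>
      obtain ⟨F, hF⟩ := F
      obtain ⟨d, rfl⟩ := E.faceOf_surjective F
      rw [← hconst d]
      simp only [L, dif_neg hF]
  · rw [← h0 ()]
    exact hG.preconnected.apply_eq (fun u v h => (hf ⟨(u, v), h⟩).symm) _ _

theorem sum_faceSize [Finite V] [Fintype E.Face] :
    ∑ F, E.faceSize F = 2 * Nat.card G.edgeSet := by
  rw [← SimpleGraph.natCard_dart]
  simp only [faceSize]
  rw [← Nat.card_sigma]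
  exact Nat.card_congr (Equiv.sigmaFiberEquiv E.faceOf)

end RotationSystem

/-! ### Faces and k-blocks of an outerplane graph: the lower bound. -/

namespace OuterplaneEmbedding

variable {V : Type*} [Fintype V] {G : SimpleGraph V} (E : OuterplaneEmbedding G)

theorem exists_outer_dart (v : V) : ∃ d : G.Dart, E.faceOf d = E.outer ∧ d.fst = v :=
  E.vertexOn_outer v

theorem card_le_faceSize_outer : Fintype.card V ≤ E.faceSize E.outer := by
  rw [← Nat.card_eq_fintype_card]
  refine Nat.card_le_card_of_surjective (fun d : {d // E.faceOf d = E.outer} => d.1.fst) fun v => ?_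
  obtain ⟨d, hd, rfl⟩ := E.exists_outer_dart v
  exact ⟨⟨d, hd⟩, rfl⟩

/-- If an inner face passed a vertex twice, cutting it there would give one face more with the same
vertices and edges. Euler's inequality still applies: every other vertex touches the outer face,
which forces a reversal-invariant potential to vanish there, and each dart at the cut vertex has its
reverse at another vertex. This contradicts Euler's formula. -/
theorem dart_eq_of_inner {d₁ d₂ : G.Dart} (h : E.faceOf d₁ = E.faceOf d₂)
    (hin : E.faceOf d₁ ≠ E.outer) (hv : d₁.fst = d₂.fst) : d₁ = d₂ := by
  classical
  by_contra hne
  let φ' := Equiv.swap d₁ d₂ * E.facePerm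
  have hnot : ¬ φ'.SameCycle d₁ d₂ :=
    Equiv.Perm.not_sameCycle_swap_mul hne (E.faceOf_eq_iff.1 h)
  have hface : ∀ d, E.faceOf (φ' d) = E.faceOf d := fun d =>
    (Equiv.apply_swap_eq h _).trans (E.faceOf_facePerm d)
  have hcyc : ∀ d, φ'.SameCycle d₁ (φ' d) ↔ φ'.SameCycle d₁ d := fun d =>
    Equiv.Perm.sameCycle_apply_right
  let L : G.Dart → Option ({F : E.Face // F ≠ E.outer} ⊕ Unit) := fun d =>
    if h : E.faceOf d = E.outer then none else
      if φ'.SameCycle d₁ d then some (Sum.inr ()) else some (Sum.inl ⟨E.faceOf d, h⟩)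
  have hL : ∀ d, L (φ' d) = L d := by
    intro d
    simp only [L, hface, hcyc]
  have key := G.card_add_card_le_add_card_edgeSet (φ := φ') (p := fun d => d.fst) (L := L)
    (r := fun _ : Unit => d₁.fst) hL
    (fun d _ => (Equiv.apply_swap_eq (f := fun d : G.Dart => d.fst) hv _).trans (E.facePerm_fst d)) (fun g hg hσ s => ?_)
    (fun f hf h0 x => ?_)
  · have h1 : Nat.card {F : E.Face // F ≠ E.outer} + 1 = Nat.card E.Face := by
      rw [← Finite.card_option]
      exact Nat.card_congr (Equiv.optionSubtypeNe E.outer)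
    have h2 := E.euler
    rw [Nat.card_sum, Nat.card_unique (α := Unit), Nat.card_eq_fintype_card (α := V)] at key
    omega
  · have hfst : ∀ d : G.Dart, d.fst ≠ d₁.fst → g (L d) = 0 := by
      intro d hd
      obtain ⟨d', hd', hdd'⟩ := E.exists_outer_dart d.fst
      have h0 : L d' = none := dif_pos hd'
      rw [← hg, ← h0]
      have := RotationSystem.apply_eq_of_fst_eq (E := E.toRotationSystem)
        (F := fun d : G.Dart => if d.fst = d₁.fst then 0 else g (L d)) (fun d => ?_) hdd'.symm
      · simpa [hd, hdd'] using this
      · simp only [E.rot_fst]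
        split_ifs with hd₁
        · rfl
        · have hrot : E.rot d = φ' d.symm := by
            rw [Equiv.Perm.mul_apply, E.facePerm_symm_apply, Equiv.swap_apply_of_ne_of_ne]
            · exact fun h => hd₁ (h ▸ (E.rot_fst d).symm)
            · exact fun h => hd₁ (((E.rot_fst d).symm.trans (h ▸ rfl)).trans hv.symm)
          rw [hrot, hL, hσ]
    have hall : ∀ d, g (L d) = 0 := by
      intro d
      by_cases hd : d.fst = d₁.fst
      · rw [← hσ]
        refine hfst _ fun h' => d.adj.ne (hd.trans h'.symm)
      · exact hfst d hd
    rcases s with _ | ⟨F, hF⟩ | _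
    · exact hg
    · by_cases hF₂ : F = E.faceOf d₂
      · have h0 : L d₂ = some (Sum.inl ⟨F, hF⟩) := by
          simp only [L, dif_neg (h ▸ hin), if_neg hnot, hF₂]
        rw [← h0, hall]
      · obtain ⟨d, rfl⟩ := E.faceOf_surjective F
        have hd : ¬ φ'.SameCycle d₁ d := fun hd =>
          hF₂ (((hd.apply_eq hface).symm).trans h)
        have h0 : L d = some (Sum.inl ⟨E.faceOf d, hF⟩) := by
          simp only [L, dif_neg hF, if_neg hd]
        rw [← h0, hall]
    · have h0 : L d₁ = some (Sum.inr ()) := by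
        simp only [L, dif_neg hin, if_pos (Equiv.Perm.SameCycle.refl φ' d₁)]
      rw [← h0, hall]
  · rw [← h0 ()]
    exact E.connected.preconnected.apply_eq (fun u v h => (hf ⟨(u, v), h⟩).symm) _ _

/-- By `dart_eq_of_inner` the boundary walk of an inner face repeats no vertex, so it is a cycle. -/
theorem cycleGraph_isContained {F : E.Face} (hF : F ≠ E.outer) {k : ℕ} (hk : 3 ≤ k)
    (hsize : E.faceSize F = k) : (SimpleGraph.cycleGraph k).IsContained G := by
  obtain ⟨n, rfl⟩ : ∃ n, k = n + 2 := ⟨k - 2, by omega⟩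
  obtain ⟨d, rfl⟩ := E.faceOf_surjective F
  set φ := E.facePerm with hφ
  have hper : d ∈ Function.periodicPts φ := by
    rw [Function.mem_periodicPts]
    exact ⟨orderOf φ, orderOf_pos φ, by
      rw [Function.IsPeriodicPt, Equiv.Perm.iterate_eq_pow, pow_orderOf_eq_one]; rfl⟩
  have hface : ∀ i : ℕ, E.faceOf (φ^[i] d) = E.faceOf d := by
    intro i
    induction i with
    | zero => rfl
    | succ i ih => rw [Function.iterate_succ_apply', hφ, E.faceOf_facePerm, ← hφ, ih]
  have hmin : Function.minimalPeriod φ d = n + 2 := by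
    rw [← hsize, RotationSystem.faceSize, ← Nat.card_fin (Function.minimalPeriod φ d)]
    refine Nat.card_congr (Equiv.ofBijective (fun i => ⟨φ^[i] d, hface i⟩) ⟨?_, ?_⟩)
    · intro i j hij
      exact Fin.ext (Function.iterate_injOn_Iio_minimalPeriod i.2 j.2 (Subtype.ext_iff.1 hij))
    · rintro ⟨d', hd'⟩
      obtain ⟨i, hi⟩ := (E.faceOf_eq_iff.1 hd'.symm).exists_nat_pow_eq
      refine ⟨⟨i % Function.minimalPeriod φ d,
        Nat.mod_lt _ (Function.minimalPeriod_pos_of_mem_periodicPts hper)⟩, Subtype.ext ?_⟩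
      simp only [Function.iterate_mod_minimalPeriod_eq]
      rw [← hi, Equiv.Perm.iterate_eq_pow]
  have hinj : Function.Injective fun i : Fin (n + 2) => (φ^[i] d).fst := by
    intro i j hij
    have := E.dart_eq_of_inner ((hface i).trans (hface j).symm) (by rwa [hface]) hij
    exact Fin.ext (Function.iterate_injOn_Iio_minimalPeriod (lt_of_lt_of_eq i.2 hmin.symm)
      (lt_of_lt_of_eq j.2 hmin.symm) this)
  have hadj : ∀ i : Fin (n + 2), G.Adj (φ^[i] d).fst (φ^[(i + 1 : Fin (n + 2))] d).fst := by
    intro i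
    have h1 : φ^[(i + 1 : Fin (n + 2))] d = φ (φ^[i] d) := by
      have h2 := Function.iterate_mod_minimalPeriod_eq (f := φ) (x := d) (n := i + 1)
      rw [hmin] at h2
      rw [← Function.iterate_succ_apply' (⇑φ), Fin.val_add, Fin.val_one, h2]
    rw [h1, hφ, E.facePerm_fst]
    exact (φ^[i] d).adj
  refine ⟨⟨⟨fun i => (φ^[i] d).fst, fun {i j} hij => ?_⟩, hinj⟩⟩
  rcases SimpleGraph.cycleGraph_adj.1 hij with h | h
  · rw [sub_eq_iff_eq_add'.1 h]
    exact (hadj j).symm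
  · rw [sub_eq_iff_eq_add'.1 h]
    exact hadj i

variable {E} {k : ℕ}

theorem FaceConnected.symm {e e' : G.edgeSet} (h : E.FaceConnected k e e') :
    E.FaceConnected k e' e :=
  have : Std.Symm fun e e' : G.edgeSet =>
      ∃ F : E.Face, E.IsSmallInnerFace k F ∧ E.EdgeOn e F ∧ E.EdgeOn e' F :=
    ⟨fun _ _ ⟨F, hF, h1, h2⟩ => ⟨F, hF, h2, h1⟩⟩
  Relation.ReflTransGen.stdSymm.symm _ _ h

theorem FaceConnected.apply_eq {Y : Type*} {F : G.Dart → Y} (hσ : ∀ d, F d.symm = F d)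
    (hφ : ∀ d, E.IsSmallInnerFace k (E.faceOf d) → F (E.facePerm d) = F d) {d d' : G.Dart}
    (h : E.FaceConnected k d.toEdge d'.toEdge) : F d = F d' := by
  generalize he : d.toEdge = e at h
  generalize he' : d'.toEdge = e' at h
  induction h generalizing d' with
  | refl => exact SimpleGraph.Dart.apply_eq_of_toEdge_eq hσ (he.trans he'.symm)
  | tail _ h ih =>
    obtain ⟨A, hA, ⟨d₁, h₁, h₁'⟩, ⟨d₂, h₂, h₂'⟩⟩ := h
    rw [@ih d₁ (Subtype.ext h₁'),
      SimpleGraph.Dart.apply_eq_of_toEdge_eq hσ (he'.trans (Subtype.ext h₂').symm : d'.toEdge = d₂.toEdge)]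
    have hs := E.faceOf_eq_iff.1 (h₁.trans h₂.symm)
    classical
    have := hs.apply_eq (F := fun d => if E.faceOf d = A then some (F d) else none) fun d => by
      simp only [E.faceOf_facePerm]
      split_ifs with h
      · rw [hφ d (h ▸ hA)]
      · rfl
    simpa [h₁, h₂] using this

theorem kBlock_eq_iff {e e' : G.edgeSet} :
    E.kBlock k e = E.kBlock k e' ↔ E.FaceConnected k e e' := by
  constructor
  · intro h
    obtain ⟨⟨u, v⟩, he'⟩ := e'
    have h1 : (E.kBlock k e).Adj u v := by
      rw [h]
      exact ⟨_, Relation.ReflTransGen.refl, rfl⟩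
    obtain ⟨e'', h2, h3⟩ := h1
    have : e'' = ⟨s(u, v), he'⟩ := Subtype.ext h3
    exact this ▸ h2
  · intro h
    have : ∀ e'', E.FaceConnected k e e'' ↔ E.FaceConnected k e' e'' := fun e'' =>
      ⟨fun h' => h.symm.trans h', fun h' => h.trans h'⟩
    ext <;> simp [kBlock, this]

/-- The index of the `k`-block containing a dart, in an enumeration of the `k`-blocks. -/
noncomputable def blockIndex {t : ℕ} (f : Fin t ≃ E.kBlocks k) (d : G.Dart) : Fin t :=
  f.symm ⟨E.kBlock k d.toEdge, d.toEdge, rfl⟩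

theorem blockIndex_symm {t : ℕ} (f : Fin t ≃ E.kBlocks k) (d : G.Dart) :
    blockIndex f d.symm = blockIndex f d := by
  simp only [blockIndex, SimpleGraph.Dart.toEdge_symm]

theorem blockIndex_eq_iff {t : ℕ} (f : Fin t ≃ E.kBlocks k) {d d' : G.Dart} :
    blockIndex f d = blockIndex f d' ↔ E.FaceConnected k d.toEdge d'.toEdge := by
  rw [blockIndex, blockIndex, f.symm.injective.eq_iff, ← kBlock_eq_iff]
  exact Subtype.ext_iff

theorem coe_apply_blockIndex {t : ℕ} (f : Fin t ≃ E.kBlocks k) (d : G.Dart) :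
    (f (blockIndex f d) : G.Subgraph) = E.kBlock k d.toEdge := by
  simp [blockIndex]

theorem blockIndex_surjective {t : ℕ} (f : Fin t ≃ E.kBlocks k) :
    Function.Surjective (blockIndex f) := by
  intro i
  obtain ⟨e, he⟩ := (f i).2
  obtain ⟨d, rfl⟩ := SimpleGraph.Dart.toEdge_surjective e
  refine ⟨d, f.injective (Subtype.ext ?_)⟩
  rw [coe_apply_blockIndex, he]

theorem blockIndex_facePerm {t : ℕ} (f : Fin t ≃ E.kBlocks k) {d : G.Dart}
    (hd : E.IsSmallInnerFace k (E.faceOf d)) :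
    blockIndex f (E.facePerm d) = blockIndex f d := by
  rw [blockIndex_eq_iff]
  exact Relation.ReflTransGen.single
    ⟨_, hd, ⟨_, E.faceOf_facePerm d, rfl⟩, ⟨_, rfl, rfl⟩⟩

theorem mem_verts_iff {t : ℕ} (f : Fin t ≃ E.kBlocks k) {i : Fin t} {v : V} :
    v ∈ (f i : G.Subgraph).verts ↔ ∃ d, blockIndex f d = i ∧ d.fst = v := by
  obtain ⟨d₀, rfl⟩ := blockIndex_surjective f i
  rw [coe_apply_blockIndex]
  constructor
  · rintro ⟨⟨e, he⟩, h, hv⟩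
    obtain ⟨w, rfl⟩ := Sym2.mem_iff_exists.1 hv
    exact ⟨⟨(v, w), he⟩, ((blockIndex_eq_iff f).2 h).symm, rfl⟩
  · rintro ⟨d, hd, rfl⟩
    exact ⟨d.toEdge, ((blockIndex_eq_iff f).1 hd.symm), Sym2.mem_mk_left _ _⟩

/-- Euler's inequality for the disjoint union of the k-blocks: a point is a vertex together with a
block containing it, all faces that are not small inner ones are merged into `none`, and each block
has one base point. -/
theorem sum_card_verts_add_card_small_le {t : ℕ} (f : Fin t ≃ E.kBlocks k) :
    (∑ i, Nat.card (f i : G.Subgraph).verts) + Nat.card {F // E.IsSmallInnerFace k F} ≤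
      t + Nat.card G.edgeSet := by
  classical
  let X := (i : Fin t) × (f i : G.Subgraph).verts
  have hmem : ∀ d, d.fst ∈ (f (blockIndex f d) : G.Subgraph).verts := fun d =>
    (mem_verts_iff f).2 ⟨d, rfl, rfl⟩
  let p : G.Dart → X := fun d => ⟨blockIndex f d, d.fst, hmem d⟩
  have hp : ∀ {d d' : G.Dart}, blockIndex f d = blockIndex f d' → d.fst = d'.fst → p d = p d' := by
    intro d d' h h'
    have : ∀ (i j : Fin t) (v w : V) (hv : v ∈ (f i : G.Subgraph).verts)
        (hw : w ∈ (f j : G.Subgraph).verts), i = j → v = w →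
        (⟨i, v, hv⟩ : X) = ⟨j, w, hw⟩ := by
      rintro i _ v _ hv hw rfl rfl
      rfl
    exact this _ _ _ _ _ _ h h'
  choose b hb using blockIndex_surjective f
  let L : G.Dart → Option {F // E.IsSmallInnerFace k F} := fun d =>
    if h : E.IsSmallInnerFace k (E.faceOf d) then some ⟨_, h⟩ else none
  have hL : ∀ d, L (E.facePerm d) = L d := by
    intro d
    simp only [L, E.faceOf_facePerm]
  have key := G.card_add_card_le_add_card_edgeSet (φ := E.facePerm) (p := p) (L := L)
    (r := fun i => p (b i)) hL (fun d hd => ?_) (fun g hg hσ s => ?_) (fun F hF h0 x => ?_)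
  · rw [Nat.card_sigma, Nat.card_fin] at key
    exact key
  · have hd : E.IsSmallInnerFace k (E.faceOf d) := by
      by_contra h
      exact hd (dif_neg h)
    exact hp ((blockIndex_facePerm f hd).trans (blockIndex_symm f d).symm) (E.facePerm_fst d)
  · have hall : ∀ d, g (L d) = 0 := by
      intro d
      obtain ⟨d', hd', -⟩ := E.exists_outer_dart d.fst
      have h0 : L d' = none := dif_neg fun h => h.1 hd'
      rw [← hg, ← h0]
      refine RotationSystem.apply_eq_of_preconnected E.connected.preconnected
        (E := E.toRotationSystem) (F := fun d => g (L d)) (fun d => ?_) hσ d d'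
      rw [← E.facePerm_symm_apply, hL, hσ]
    rcases s with _ | ⟨F, hF⟩
    · exact hg
    · obtain ⟨d, rfl⟩ := E.faceOf_surjective F
      rw [← hall d]
      simp only [L, dif_pos hF]
  · obtain ⟨i, v, hv⟩ := x
    obtain ⟨d, rfl, rfl⟩ := (mem_verts_iff f).1 hv
    rw [← h0 (blockIndex f d)]
    refine FaceConnected.apply_eq (E := E) (k := k) (F := fun d => F (p d)) hF (fun d hd => ?_)
      ((blockIndex_eq_iff f).1 (hb _).symm)
    rw [← hF d]
    exact congr_arg F (hp ((blockIndex_facePerm f hd).trans (blockIndex_symm f d).symm)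
      (E.facePerm_fst d))

/-- The incidence structure of edges and small inner faces has t components. A function on edges is
determined by its value at one edge per block and its differences to a base dart of each small face,
the base darts themselves (excluded from `J`) contributing nothing. -/
theorem card_edgeSet_add_card_small_le [Fintype {F // E.IsSmallInnerFace k F}] {t : ℕ}
    (f : Fin t ≃ E.kBlocks k) :
    Nat.card G.edgeSet + Nat.card {F // E.IsSmallInnerFace k F} ≤
      t + ∑ F : {F // E.IsSmallInnerFace k F}, E.faceSize F := by
  classical
  choose b hb using blockIndex_surjective f
  choose c hc using E.faceOf_surjective
  let J := {d : G.Dart // E.IsSmallInnerFace k (E.faceOf d) ∧ d ≠ c (E.faceOf d)}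
  have hJ : Nat.card J + Nat.card {F // E.IsSmallInnerFace k F} =
      ∑ F : {F // E.IsSmallInnerFace k F}, E.faceSize F := by
    simp only [RotationSystem.faceSize]
    rw [← Nat.card_sigma, ← Nat.card_sum]
    refine Nat.card_congr (Equiv.ofBijective
      (Sum.elim (fun d => ⟨⟨_, d.2.1⟩, d.1, rfl⟩) (fun F => ⟨F, c F, hc F⟩)) ⟨?_, ?_⟩)
    · have hval : ∀ a b : (F : {F // E.IsSmallInnerFace k F}) × {d // E.faceOf d = F}, a = b → a.2.1 = b.2.1 := by
        rintro a _ rfl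
        rfl
      rintro (⟨d, h, h'⟩ | ⟨F, hF⟩) (⟨d₁, h₁, h₁'⟩ | ⟨F₁, hF₁⟩) heq
      · have := hval _ _ heq
        simp only [Sum.elim_inl] at this
        subst this
        rfl
      · have := hval _ _ heq
        simp only [Sum.elim_inl, Sum.elim_inr] at this
        exact absurd (by rw [this, hc]) h'
      · have := hval _ _ heq
        simp only [Sum.elim_inl, Sum.elim_inr] at this
        exact absurd (by rw [← this, hc]) h₁'
      · have := congr_arg Sigma.fst heq
        simp only [Sum.elim_inr] at this
        rw [this]
    · rintro ⟨⟨F, hF⟩, d, hd⟩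
      change E.faceOf d = F at hd
      subst hd
      by_cases h : d = c (E.faceOf d)
      · refine ⟨Sum.inr ⟨_, hF⟩, ?_⟩
        simp only [Sum.elim_inr, Sigma.mk.injEq, heq_eq_eq, true_and, Subtype.mk.injEq]
        exact h.symm
      · exact ⟨Sum.inl ⟨d, hF, h⟩, rfl⟩
  let Ψ : (G.edgeSet → ℚ) →ₗ[ℚ] (Fin t → ℚ) × (J → ℚ) :=
    { toFun := fun κ => (fun i => κ (b i).toEdge,
        fun d => κ d.1.toEdge - κ (c (E.faceOf d.1)).toEdge)
      map_add' := fun κ κ' => by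
        ext <;> simp
        ring
      map_smul' := fun a κ => by
        ext <;> simp
        ring }
  have hΨ : Function.Injective Ψ := by
    rw [injective_iff_map_eq_zero]
    intro κ h0
    have h1 : ∀ i, κ (b i).toEdge = 0 := fun i => congr_fun (congr_arg Prod.fst h0) i
    have h2 : ∀ d, E.IsSmallInnerFace k (E.faceOf d) →
        κ d.toEdge = κ (c (E.faceOf d)).toEdge := by
      intro d hd
      by_cases h : d = c (E.faceOf d)
      · rw [← h]
      · exact sub_eq_zero.1 (congr_fun (congr_arg Prod.snd h0) (⟨d, hd, h⟩ : J))
    ext e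
    obtain ⟨d, rfl⟩ := SimpleGraph.Dart.toEdge_surjective e
    rw [Pi.zero_apply, ← h1 (blockIndex f d)]
    refine FaceConnected.apply_eq (E := E) (k := k) (F := fun d => κ d.toEdge)
      (fun d => congr_arg κ d.toEdge_symm) (fun d hd => ?_)
      ((blockIndex_eq_iff f).1 (hb _).symm)
    rw [h2 d hd, h2 _ ((E.faceOf_facePerm d).symm ▸ hd), E.faceOf_facePerm]
  cases nonempty_fintype G.edgeSet
  cases nonempty_fintype J
  have := LinearMap.finrank_le_finrank_of_injective hΨ
  simp only [Module.finrank_prod, Module.finrank_fintype_fun_eq_card, 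
    ← Nat.card_eq_fintype_card] at this
  rw [Nat.card_fin] at this
  omega

/-- The lower bound for the number of vertices in terms of the `k`-blocks. -/
theorem sum_card_verts_le (hk : 3 ≤ k) (hfree : (SimpleGraph.cycleGraph k).Free G) {t : ℕ}
    (f : Fin t ≃ E.kBlocks k) :
    (∑ i, Nat.card (f i : G.Subgraph).verts) + 1 ≤ Fintype.card V + t + (t - 1) / k := by
  classical
  cases nonempty_fintype E.Face
  have h1 := sum_card_verts_add_card_small_le f
  have h2 := card_edgeSet_add_card_small_le f
  have h3 := E.card_le_faceSize_outer
  have h4 := E.sum_faceSize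
  have h5 := E.euler
  have houter : ¬ E.IsSmallInnerFace k E.outer := fun h => h.1 rfl
  let P : Finset E.Face := Finset.univ.filter fun F => E.IsSmallInnerFace k F
  let Q : Finset E.Face := (Finset.univ.filter fun F => ¬ E.IsSmallInnerFace k F).erase E.outer
  have hsum : ∑ F ∈ P, E.faceSize F + (E.faceSize E.outer + ∑ F ∈ Q, E.faceSize F) =
      ∑ F, E.faceSize F := by
    rw [Finset.add_sum_erase _ _ (by simp [houter]), Finset.sum_filter_add_sum_filter_not]
  have hcard : P.card + (1 + Q.card) = Nat.card E.Face := by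
    rw [add_comm 1, Finset.card_erase_add_one (by simp [houter]), Finset.card_filter_add_card_filter_not,
      Finset.card_univ, Nat.card_eq_fintype_card]
  have hP : P.card = Nat.card {F // E.IsSmallInnerFace k F} := by
    rw [Nat.card_eq_fintype_card, Fintype.card_subtype]
  have hPs : ∑ F : {F // E.IsSmallInnerFace k F}, E.faceSize F = ∑ F ∈ P, E.faceSize F :=
    Finset.sum_subtype P (by simp [P]) _ |>.symm
  -- `Q` consists of the large inner faces; size exactly k would produce a C_k.
  have hQ : Q.card * (k + 1) ≤ ∑ F ∈ Q, E.faceSize F := by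
    rw [← smul_eq_mul]
    refine Finset.card_nsmul_le_sum _ _ _ fun F hF => ?_
    simp only [Q, Finset.mem_erase, Finset.mem_filter, Finset.mem_univ, true_and] at hF
    obtain ⟨hF1, hF2⟩ := hF
    have h6 : k ≤ E.faceSize F := by
      by_contra h
      exact hF2 ⟨hF1, not_le.1 h⟩
    refine lt_of_le_of_ne h6 fun h => hfree (E.cycleGraph_isContained hF1 hk h.symm)
  rw [mul_add, mul_one] at hQ
  -- Euler's formula gives |E| - |V| - |P| = |Q| - 1. The face sizes sum to 2|E|, so what is left
  -- for `Q` is at most |Q| + t - 1, while each face in `Q` takes at least k + 1.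
  have hQt : Q.card ≤ (t - 1) / k := by
    rw [Nat.le_div_iff_mul_le (by omega)]
    omega
  omega

end OuterplaneEmbedding

/-! ### Trivial k-blocks: the outer face passes each vertex once. -/

/-- If the outer face passed a vertex twice, both the vertex and the face could be cut there. The
graph stays connected, since the remaining vertices are connected among themselves and every dart at
the cut vertex leads to them. One vertex and one face more with the same edges violate Euler's
inequality. -/
theorem IsTwoConnected.dart_eq_of_outer {V : Type*} [Fintype V] {G : SimpleGraph V}
    (hG : IsTwoConnected G) (E : OuterplaneEmbedding G) {d₁ d₂ : G.Dart}
    (h₁ : E.faceOf d₁ = E.outer) (h₂ : E.faceOf d₂ = E.outer) (hv : d₁.fst = d₂.fst) :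
    d₁ = d₂ := by
  classical
  by_contra hne
  obtain ⟨hcard, hconn, hdel⟩ := hG
  have : Nontrivial V := Fintype.one_lt_card_iff_nontrivial.1 (by omega)
  choose δ hδ using hconn.preconnected.exists_dart_fst
  let ρ' := Equiv.swap d₁ d₂ * E.rot
  let φ' := Equiv.swap d₁ d₂ * E.facePerm
  have hρφ : ∀ d : G.Dart, φ' d = ρ' d.symm := fun d => rfl
  have hnotφ : ¬ φ'.SameCycle d₁ d₂ :=
    Equiv.Perm.not_sameCycle_swap_mul hne (E.faceOf_eq_iff.1 (h₁.trans h₂.symm))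
  have hnotρ : ¬ ρ'.SameCycle d₁ d₂ :=
    Equiv.Perm.not_sameCycle_swap_mul hne (E.rot_cyclic _ _ hv)
  have hfst : ∀ d, (ρ' d).fst = d.fst := fun d =>
    (Equiv.apply_swap_eq (f := fun d : G.Dart => d.fst) hv _).trans (E.rot_fst d)
  have hface : ∀ d, E.faceOf (φ' d) = E.faceOf d := fun d =>
    (Equiv.apply_swap_eq (h₁.trans h₂.symm) _).trans (E.faceOf_facePerm d)
  let L : G.Dart → Option ({F : E.Face // F ≠ E.outer} ⊕ Unit) := fun d =>
    if h : E.faceOf d = E.outer then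
      if φ'.SameCycle d₁ d then some (Sum.inr ()) else none else some (Sum.inl ⟨E.faceOf d, h⟩)
  let p : G.Dart → Option V := fun d => if ρ'.SameCycle d₁ d then none else some d.fst
  have hL : ∀ d, L (φ' d) = L d := by
    intro d
    simp only [L, hface, Equiv.Perm.sameCycle_apply_right]
  have hp : ∀ d, p (φ' d) = p d.symm := by
    intro d
    simp only [p, hρφ, Equiv.Perm.sameCycle_apply_right, hfst]
  have hL₂ : L d₂ = none := by simp only [L, dif_pos h₂, if_neg hnotφ]
  have hpne : ∀ d : G.Dart, d.fst ≠ d₁.fst → p d = some d.fst := by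
    intro d hd
    exact if_neg fun h => hd (h.apply_eq (F := fun d : G.Dart => d.fst) hfst).symm
  have hopp : ∀ d : G.Dart, d.fst = d₁.fst → d.symm.fst ≠ d₁.fst := fun d hd h =>
    d.adj.ne (hd.trans h.symm)
  have key := G.card_add_card_le_add_card_edgeSet (φ := φ') (p := p) (L := L)
    (r := fun _ : Unit => p d₂) hL (fun d _ => hp d) (fun g hg hσ s => ?_) (fun f hf h0 x => ?_)
  · have h3 : Nat.card {F : E.Face // F ≠ E.outer} + 1 = Nat.card E.Face := by
      rw [← Finite.card_option]
      exact Nat.card_congr (Equiv.optionSubtypeNe E.outer)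
    have h4 := E.euler
    rw [Nat.card_sum, Nat.card_unique (α := Unit), Finite.card_option,
      Nat.card_eq_fintype_card (α := V)] at key
    omega
  · have hδd : ∀ d : G.Dart, d.fst ≠ d₁.fst → g (L d) = g (L (δ d.fst)) := by
      intro d hd
      have := RotationSystem.apply_eq_of_fst_eq (E := E.toRotationSystem)
        (F := fun d : G.Dart => if d.fst = d₁.fst then 0 else g (L d)) (fun d => ?_)
        (hδ d.fst).symm
      · simpa [hd, hδ] using this
      · simp only [E.rot_fst]
        split_ifs with hd₁
        · rfl
        · have hrot : E.rot d = φ' d.symm := by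
            rw [Equiv.Perm.mul_apply, E.facePerm_symm_apply, Equiv.swap_apply_of_ne_of_ne]
            · exact fun h => hd₁ (h ▸ (E.rot_fst d).symm)
            · exact fun h => hd₁ (((E.rot_fst d).symm.trans (h ▸ rfl)).trans hv.symm)
          rw [hrot, hL, hσ]
    have hconst : ∀ d d' : G.Dart, d.fst ≠ d₁.fst → d'.fst ≠ d₁.fst → g (L d) = g (L d') := by
      intro d d' hd hd'
      rw [hδd d hd, hδd d' hd']
      refine (hdel d₁.fst).preconnected.apply_eq (f := fun w => g (L (δ w.1)))
        (fun u w huw => ?_) ⟨d.fst, hd⟩ ⟨d'.fst, hd'⟩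
      have e1 := hδd ⟨(u.1, w.1), huw⟩ u.2
      have e2 := hδd ⟨(w.1, u.1), huw.symm⟩ w.2
      simp only at e1 e2
      rw [← e1, ← e2]
      exact (hσ ⟨(u.1, w.1), huw⟩).symm
    have hall : ∀ d, g (L d) = 0 := by
      have h0 : ∀ d : G.Dart, ∃ d' : G.Dart, d'.fst ≠ d₁.fst ∧ g (L d') = g (L d) := by
        intro d
        by_cases hd : d.fst = d₁.fst
        · exact ⟨d.symm, hopp d hd, hσ d⟩
        · exact ⟨d, hd, rfl⟩
      intro d
      obtain ⟨a, ha, ha'⟩ := h0 d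
      obtain ⟨b, hb, hb'⟩ := h0 d₂
      rw [← ha', hconst a b ha hb, hb', hL₂, hg]
    rcases s with _ | ⟨F, hF⟩ | _
    · exact hg
    · obtain ⟨d, rfl⟩ := E.faceOf_surjective F
      rw [← hall d]
      simp only [L, dif_neg hF]
    · rw [← hall d₁]
      simp only [L, dif_pos h₁, if_pos (Equiv.Perm.SameCycle.refl φ' d₁)]
  · have hconst : ∀ u w : V, u ≠ d₁.fst → w ≠ d₁.fst → f (some u) = f (some w) := by
      intro u w hu hw
      refine (hdel d₁.fst).preconnected.apply_eq (f := fun w => f (some w.1))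
        (fun u w huw => ?_) ⟨u, hu⟩ ⟨w, hw⟩
      have := hf ⟨(u.1, w.1), huw⟩
      rw [hpne ⟨(u.1, w.1), huw⟩ u.2, hpne (SimpleGraph.Dart.symm ⟨(u.1, w.1), huw⟩) w.2] at this
      exact this.symm
    have hd₂ : p d₂ = some d₁.fst := (if_neg hnotρ).trans (congr_arg some hv.symm)
    have hne0 : ∀ u, u ≠ d₁.fst → f (some u) = 0 := by
      intro u hu
      rw [← h0 (), ← hf d₂, hpne _ (hopp _ hv.symm)]
      exact hconst _ _ hu (hopp _ hv.symm)
    rcases x with _ | u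
    · have hd₁ : p d₁ = none := if_pos (Equiv.Perm.SameCycle.refl ρ' d₁)
      rw [← hd₁, ← hf d₁, hpne _ (hopp _ rfl)]
      exact hne0 _ (hopp _ rfl)
    · by_cases hu : u = d₁.fst
      · rw [hu, ← hd₂]
        exact h0 ()
      · exact hne0 u hu

namespace SimpleGraph

variable {V : Type*} [Fintype V] {G : SimpleGraph V}

theorem dart_eq_of_card_eq_two (hV : Fintype.card V = 2) {d d' : G.Dart} (h : d.fst = d'.fst) :
    d = d' := by
  refine Dart.ext _ _ (Prod.ext h ?_)
  by_contra hne
  have := Fintype.two_lt_card_iff.2 ⟨d.fst, d.snd, d'.snd, d.adj.ne, h ▸ d'.adj.ne, hne⟩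
  omega

theorem exists_outerplaneEmbedding_of_card_eq_two (hV : Fintype.card V = 2) (hG : G.Connected) :
    ∃ E : OuterplaneEmbedding G, ∀ F, F = E.outer := by
  have : Nontrivial V := Fintype.one_lt_card_iff_nontrivial.1 (by omega)
  choose δ hδ using hG.preconnected.exists_dart_fst
  have hdart : Nat.card G.Dart = 2 := by
    rw [← hV, ← Nat.card_eq_fintype_card]
    exact Nat.card_congr (Equiv.ofBijective (fun d => d.fst)
      ⟨fun d d' h => dart_eq_of_card_eq_two hV h, fun v => ⟨δ v, hδ v⟩⟩)
  have hedge : Nat.card G.edgeSet = 1 := by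
    have := G.natCard_dart
    omega
  let E : RotationSystem G :=
    { rot := 1
      rot_fst := fun _ => rfl
      rot_cyclic := fun d d' h => dart_eq_of_card_eq_two hV h ▸ Equiv.Perm.SameCycle.refl _ _ }
  have hface : ∀ d d', E.faceOf d = E.faceOf d' := by
    intro d d'
    by_cases h : d.fst = d'.fst
    · rw [dart_eq_of_card_eq_two hV h]
    · have h' : d'.symm = d := by
        refine dart_eq_of_card_eq_two hV ?_
        by_contra hne
        have := Fintype.two_lt_card_iff.2
          ⟨d.fst, d'.fst, d'.snd, h, fun h => hne h.symm, d'.adj.ne⟩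
        omega
      rw [← E.faceOf_facePerm d', ← h']
      rfl
  obtain ⟨v⟩ := hG.nonempty
  have hF : ∀ F, F = E.faceOf (δ v) := by
    intro F
    obtain ⟨d, rfl⟩ := E.faceOf_surjective F
    exact hface _ _
  refine ⟨{ toRotationSystem := E
            connected := hG
            euler := ?_
            outer := E.faceOf (δ v)
            vertexOn_outer := fun w => ⟨δ w, hface _ _, hδ w⟩ }, hF⟩
  have : Subsingleton E.Face := ⟨fun a b => (hF a).trans (hF b).symm⟩
  have : Nonempty E.Face := ⟨E.faceOf (δ v)⟩
  rw [Nat.card_unique, hedge, hV]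

end SimpleGraph

theorem IsTrivialKBlock.connected {V : Type*} [Fintype V] {G : SimpleGraph V} {k : ℕ}
    (h : IsTrivialKBlock k G) : G.Connected := by
  rcases h with ⟨⟨e⟩⟩ | ⟨h, -⟩
  · exact e.connected_iff.2 SimpleGraph.connected_top
  · exact h.2.1

theorem IsTrivialKBlock.nontrivial {V : Type*} [Fintype V] {G : SimpleGraph V} {k : ℕ}
    (h : IsTrivialKBlock k G) : Nontrivial V := by
  rcases h with ⟨⟨e⟩⟩ | ⟨h, -⟩
  · exact e.toEquiv.nontrivial
  · exact Fintype.one_lt_card_iff_nontrivial.1 (by have := h.1; omega)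

theorem IsTrivialKBlock.exists_embedding {V : Type*} [Fintype V] {G : SimpleGraph V} {k : ℕ}
    (h : IsTrivialKBlock k G) : ∃ E : OuterplaneEmbedding G,
      (∀ F : E.Face, F ≠ E.outer → E.faceSize F < k) ∧
      ∀ d d', E.faceOf d = E.outer → E.faceOf d' = E.outer → d.fst = d'.fst → d = d' := by
  have hG := h.connected
  rcases h with ⟨⟨e⟩⟩ | ⟨h, E, hE⟩
  · have hV : Fintype.card V = 2 := by rw [Fintype.card_congr e.toEquiv, Fintype.card_fin]
    obtain ⟨E, hE⟩ := SimpleGraph.exists_outerplaneEmbedding_of_card_eq_two hV hG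
    exact ⟨E, fun F hF => absurd (hE F) hF,
      fun d d' _ _ h => SimpleGraph.dart_eq_of_card_eq_two hV h⟩
  · exact ⟨E, hE, fun d d' h₁ h₂ hv => h.dart_eq_of_outer E h₁ h₂ hv⟩

/-! ### The combinatorial pattern of the extremal gluing. -/

/-- The combinatorial pattern of an extremal gluing of `t` polygons, given by the cycles of `φ₀`
on the set `Out`: the permutation `π` glues corners in such a way that `π * φ₀` has `s` cycles
(rings) inside `Out`, each of which has length at least `k`. -/
structure RingGluing {D : Type*} {t : ℕ} (β : D → Fin t) (Out : Set D) (φ₀ : Equiv.Perm D)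
    (k s : ℕ) where
  π : Equiv.Perm D
  ring : D → Option (Fin s)
  apply_of_not_mem : ∀ d ∉ Out, π d = d
  ring_of_not_mem : ∀ d ∉ Out, ring d = none
  ring_apply : ∀ d, ring (π (φ₀ d)) = ring d
  le_card_ring : ∀ m, k ≤ Nat.card {d // ring d = some m}
  exists_ring_eq_none : ∀ d ∈ Out, ∃ d' ∈ Out, ring d' = none ∧ π.SameCycle d d'
  iff_of_invariant : ∀ P : D → Prop, (∀ d, P (π d) ↔ P d) →
    (∀ d d', β d = β d' → (P d ↔ P d')) → ∀ d d', P d ↔ P d'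
  u : Fin (t - 1) ⊕ Fin s → D
  v : Fin (t - 1) ⊕ Fin s → D
  apply_iff : ∀ P : D → Prop, (∀ i, P (u i) ↔ P (v i)) → ∀ d, P (π d) ↔ P d
  eq_zero_of_card_le : ∀ (γ : Option (Fin s) → ℚ) (J : Finset (Fin t)), γ none = 0 → J.card ≤ k →
    (∀ d ∈ Out, ∀ d' ∈ Out, β d = β d' → β d ∉ J → γ (ring d) = γ (ring d')) → ∀ m, γ m = 0

-- Block j offers consecutive outer corners `a j`, `b j`, `c j`. Ring m consists of `b (m * k)` and
-- `a j` for m * k < j ≤ m * k + k. All `b (m * k)` are glued to one hub, so the rings form a fan in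
-- which block m * k + k contributes the side from `a` to `b` to ring m and the side from `b` to `c`
-- to ring m + 1. For K₂ these are the two sides of one edge, with `c j = a j`.
open Classical in
theorem exists_ringGluing {D : Type*} [Finite D] {t : ℕ} {β : D → Fin t} {Out : Set D}
    {φ₀ : Equiv.Perm D} {k s : ℕ} (ht : 1 ≤ t) (hk : 3 ≤ k) (hs : s * k ≤ t - 1)
    (hβ : ∀ d, β (φ₀ d) = β d) (hOut : ∀ d, φ₀ d ∈ Out ↔ d ∈ Out) (a₀ : Fin t → D)
    (hβa : ∀ i, β (a₀ i) = i) (ha : ∀ i, a₀ i ∈ Out) (hne : ∀ i, φ₀ (a₀ i) ≠ a₀ i) :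
    Nonempty (RingGluing β Out φ₀ k s) := by
  obtain ⟨N, hN⟩ : ∃ N, N = s * k := ⟨_, rfl⟩
  have hmk : ∀ m : Fin s, m * k + k ≤ N := fun m => by
    rw [hN, ← Nat.succ_mul]
    exact Nat.mul_le_mul_right k m.2
  have hmul : ∀ {m n : ℕ}, m * k = n * k → m = n := fun h =>
    Nat.eq_of_mul_eq_mul_right (by omega) h
  have hlt : ∀ {m n : ℕ}, m * k < n * k + k → m ≤ n := fun {m n} h => by
    rw [← Nat.succ_mul] at h
    exact Nat.lt_succ_iff.1 (Nat.lt_of_mul_lt_mul_right h)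
  let idx : ℕ → Fin t := fun j => if h : j < t then ⟨j, h⟩ else ⟨0, ht⟩
  have hidx : ∀ {i j : ℕ}, i < t → j < t → idx i = idx j → i = j := by
    intro i j hi hj h
    simpa only [idx, dif_pos hi, dif_pos hj, Fin.mk.injEq] using h
  let a : ℕ → D := fun j => a₀ (idx j)
  let b : ℕ → D := fun j => φ₀ (a j)
  let c : ℕ → D := fun j => φ₀ (b j)
  have hβ' : (∀ j, β (a j) = idx j) ∧ (∀ j, β (b j) = idx j) ∧ ∀ j, β (c j) = idx j := by
    refine ⟨fun j => hβa _, fun j => ?_, fun j => ?_⟩ <;> simp only [c, b, a, hβ, hβa]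
  obtain ⟨hβa', hβb, hβc⟩ := hβ'
  have haO : ∀ j, a j ∈ Out := fun j => ha _
  have hbO : ∀ j, b j ∈ Out := fun j => (hOut _).2 (haO j)
  have hcO : ∀ j, c j ∈ Out := fun j => (hOut _).2 (hbO j)
  have hba : ∀ j, b j ≠ a j := fun j => hne _
  have hcb : ∀ j, c j ≠ b j := fun j h => hne _ (φ₀.injective h)
  have haa : ∀ {i j : ℕ}, i < t → j < t → a i = a j → i = j := fun hi hj h =>
    hidx hi hj (by rw [← hβa', ← hβa', h])
  have hbb : ∀ {i j : ℕ}, i < t → j < t → b i = b j → i = j := fun hi hj h =>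
    hidx hi hj (by rw [← hβb, ← hβb, h])
  have hab : ∀ {i j : ℕ}, i < t → j < t → a i ≠ b j := fun {i j} hi hj h => by
    have := hidx hi hj (by rw [← hβa', ← hβb, h])
    subst this
    exact hba i h.symm
  have hcb' : ∀ {i j : ℕ}, i < t → j < t → c i ≠ b j := fun {i j} hi hj h => by
    have := hidx hi hj (by rw [← hβc, ← hβb, h])
    subst this
    exact hcb i h
  have hca : ∀ {i j : ℕ}, i < t → j < t → c i = a j → i = j := fun hi hj h =>
    hidx hi hj (by rw [← hβc, ← hβa', h])
  -- The first t - 1 pairs attach block j + 1: to block j while j < N, and to the hub corner `b N`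
  -- from then on. When k divides j, `b j` is the hub and the next block is attached at `c j`. The
  -- last s pairs close the rings.
  let u : Fin (t - 1) ⊕ Fin s → D := Sum.elim
    (fun j => if j + 1 ≤ N then if k ∣ j then c j else b j else a (j + 1))
    (fun m => b (m * k + k))
  let v : Fin (t - 1) ⊕ Fin s → D := Sum.elim
    (fun j => if (j : ℕ) + 1 ≤ N then a (j + 1) else if j = N then b N else a j)
    (fun m => b (m * k))
  have hu : Function.Injective u := by
    rintro (⟨i, hi⟩ | i) (⟨j, hj⟩ | j) h
    · simp only [u, Sum.elim_inl] at h
      have : i = j := by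
        split_ifs at h <;> have h' := congr_arg β h <;> simp only [hβa', hβb, hβc] at h' <;>
          have := hidx (by omega) (by omega) h' <;> omega
      subst this
      rfl
    · have hj' := hmk j
      simp only [u, Sum.elim_inl, Sum.elim_inr] at h
      split_ifs at h with h1 h2
      · exact absurd h (hcb' (by omega) (by omega))
      · exact absurd ⟨j + 1, by rw [hbb (by omega) (by omega) h]; ring⟩ h2
      · exact absurd h (hab (by omega) (by omega))
    · have hi' := hmk i
      simp only [u, Sum.elim_inl, Sum.elim_inr] at h
      split_ifs at h with h1 h2
      · exact absurd h.symm (hcb' (by omega) (by omega))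
      · exact absurd ⟨i + 1, by rw [← hbb (by omega) (by omega) h]; ring⟩ h2
      · exact absurd h.symm (hab (by omega) (by omega))
    · have hi' := hmk i
      have hj' := hmk j
      have := hbb (by omega) (by omega) h
      exact congr_arg Sum.inr (Fin.ext (hmul (by omega)))
  have hv : Function.Injective v := by
    rintro (⟨i, hi⟩ | i) (⟨j, hj⟩ | j) h
    · simp only [v, Sum.elim_inl] at h
      have : i = j := by
        split_ifs at h
        all_goals first
          | omega
          | exact absurd h (hab (by omega) (by omega))
          | exact absurd h.symm (hab (by omega) (by omega))
          | (have := haa (by omega) (by omega) h; omega)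
      subst this
      rfl
    · have hj' := hmk j
      simp only [v, Sum.elim_inl, Sum.elim_inr] at h
      split_ifs at h with h1 h2
      · exact absurd h (hab (by omega) (by omega))
      · have := hbb (by omega) (by omega) h
        omega
      · exact absurd h (hab (by omega) (by omega))
    · have hi' := hmk i
      simp only [v, Sum.elim_inl, Sum.elim_inr] at h
      split_ifs at h with h1 h2
      · exact absurd h.symm (hab (by omega) (by omega))
      · have := hbb (by omega) (by omega) h
        omega
      · exact absurd h.symm (hab (by omega) (by omega))
    · have hi' := hmk i
      have hj' := hmk j
      have := hbb (by omega) (by omega) h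
      exact congr_arg Sum.inr (Fin.ext (hmul this))
  have huO : ∀ i, u i ∈ Out := by
    rintro (i | i)
    · simp only [u, Sum.elim_inl]
      split_ifs
      exacts [hcO _, hbO _, haO _]
    · exact hbO _
  have hvO : ∀ i, v i ∈ Out := by
    rintro (i | i)
    · simp only [v, Sum.elim_inl]
      split_ifs
      exacts [haO _, hbO _, haO _]
    · exact hbO _
  obtain ⟨π, hπ, hP⟩ := Equiv.Perm.exists_extend hu hv
  have hπr : ∀ m : Fin s, π (b (m * k + k)) = b (m * k) := fun m => hπ (Sum.inr m)
  have hπb : ∀ j, j + 1 ≤ N → ¬ k ∣ j → π (b j) = a (j + 1) := by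
    intro j hj hkj
    have := hπ (Sum.inl ⟨j, by omega⟩)
    simpa only [u, v, Sum.elim_inl, if_pos hj, if_neg hkj] using this
  have hπc : ∀ j, j + 1 ≤ N → k ∣ j → π (c j) = a (j + 1) := by
    intro j hj hkj
    have := hπ (Sum.inl ⟨j, by omega⟩)
    simpa only [u, v, Sum.elim_inl, if_pos hj, if_pos hkj] using this
  have hndvd : ∀ {m j : ℕ}, m * k < j → j < m * k + k → ¬ k ∣ j := by
    rintro m _ h1 h2 ⟨n, rfl⟩
    rw [mul_comm k n] at h1 h2
    have := hlt h2
    exact absurd (Nat.mul_le_mul_right k this) (by omega)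
  let R : Fin s → D → Prop := fun m d =>
    (∃ j, m * k < j ∧ j ≤ m * k + k ∧ d = a j) ∨ d = b (m * k)
  have hRu : ∀ {m n : Fin s} {d}, R m d → R n d → m = n := by
    intro m n d h1 h2
    have hm := hmk m
    have hn := hmk n
    rcases h1 with ⟨i, hi, hi', rfl⟩ | rfl <;> rcases h2 with ⟨j, hj, hj', h⟩ | h
    · have := haa (by omega) (by omega) h
      subst this
      exact Fin.ext (le_antisymm (hlt (by omega)) (hlt (by omega)))
    · exact absurd h (hab (by omega) (by omega))
    · exact absurd h.symm (hab (by omega) (by omega))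
    · exact Fin.ext (hmul (hbb (by omega) (by omega) h))
  let ring : D → Option (Fin s) := fun d => if h : ∃ m, R m d then some h.choose else none
  have hring : ∀ {d m}, ring d = some m ↔ R m d := by
    intro d m
    simp only [ring]
    split_ifs with h
    · rw [Option.some.injEq]
      exact ⟨fun h' => h' ▸ h.choose_spec, fun h' => hRu h.choose_spec h'⟩
    · simp only [false_iff]
      exact fun h' => h ⟨m, h'⟩
  have hring0 : ∀ {d}, (∀ m, ¬ R m d) → ring d = none := fun h =>
    dif_neg fun ⟨m, hm⟩ => h m hm
  have hringO : ∀ d ∉ Out, ring d = none := by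
    refine fun d hd => hring0 fun m => ?_
    rintro (⟨j, -, -, rfl⟩ | rfl)
    exacts [hd (haO j), hd (hbO _)]
  have hring_a : ∀ (m : Fin s) j, m * k < j → j ≤ m * k + k → ring (a j) = some m :=
    fun m j h1 h2 => hring.2 (Or.inl ⟨j, h1, h2, rfl⟩)
  have hring_b : ∀ m : Fin s, ring (b (m * k)) = some m := fun m => hring.2 (Or.inr rfl)
  have hring_b' : ∀ j < t, (∀ m : Fin s, j ≠ m * k) → ring (b j) = none := by
    refine fun j hj h => hring0 fun m => ?_
    have hm := hmk m
    rintro (⟨i, hi, hi', h'⟩ | h')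
    · exact hab (by omega) (by omega) h'.symm
    · exact h m (hbb (by omega) (by omega) h')
  have hring_bN : ring (b N) = none := hring_b' N (by omega) fun m => by
    have := hmk m
    omega
  have hring_a0 : ring (a 0) = none := hring0 fun m => by
    have hm := hmk m
    rintro (⟨i, hi, hi', h'⟩ | h')
    · have := haa (by omega) (by omega) h'
      omega
    · exact hab (by omega) (by omega) h'
  have hRφ : ∀ m d, R m d → R m (π (φ₀ d)) := by
    rintro m d (⟨j, hj, hj', rfl⟩ | rfl)
    · have hm := hmk m
      change R m (π (b j))
      by_cases h : j = m * k + k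
      · rw [h, hπr]
        exact Or.inr rfl
      · rw [hπb j (by omega) (hndvd hj (by omega))]
        exact Or.inl ⟨j + 1, by omega, by omega, rfl⟩
    · have hm := hmk m
      change R m (π (c (m * k)))
      rw [hπc _ (by omega) (Dvd.intro_left _ rfl)]
      exact Or.inl ⟨_, by omega, by omega, rfl⟩
  have hRφ' : ∀ m d, R m (π (φ₀ d)) ↔ R m d := by
    refine fun m d => ⟨fun h => ?_, hRφ m d⟩
    have := Equiv.Perm.perm_symm_on_of_perm_on_finite (f := π * φ₀) (p := R m) (hRφ m) h
    change R m ((π * φ₀).symm ((π * φ₀) d)) at this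
    rwa [Equiv.symm_apply_apply] at this
  have hpred : ∀ j, 1 ≤ j → j ≤ N → ¬ k ∣ (j - 1) →
      ∃ d' ∈ Out, ring d' = none ∧ π.SameCycle (a j) d' := by
    intro j h1 h2 h3
    refine ⟨b (j - 1), hbO _, hring_b' _ (by omega) fun m h => h3 (h ▸ Dvd.intro_left _ rfl), ?_⟩
    have := hπb (j - 1) (by omega) h3
    rw [Nat.sub_add_cancel h1] at this
    exact Equiv.Perm.SameCycle.symm ⟨1, by simpa using this⟩
  refine ⟨{ π := π, ring := ring, u := u, v := v, apply_iff := hP, ring_of_not_mem := hringO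
            apply_of_not_mem := ?_, ring_apply := ?_, le_card_ring := ?_
            exists_ring_eq_none := ?_, iff_of_invariant := ?_, eq_zero_of_card_le := ?_ }⟩
  · intro d hd
    refine (hP (fun x => x = d) (fun i => ?_) d).2 rfl
    exact ⟨fun h => absurd (h ▸ huO i) hd, fun h => absurd (h ▸ hvO i) hd⟩
  · intro d
    refine Option.ext fun m => ?_
    rw [hring, hring, hRφ']
  · intro m
    have hm := hmk m
    have hinj : Function.Injective fun i : Fin k => (⟨a (m * k + 1 + i),
        hring_a m _ (by omega) (by omega)⟩ : {d // ring d = some m}) := by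
      intro i j h
      have := haa (by omega) (by omega) (Subtype.ext_iff.1 h)
      exact Fin.ext (by omega)
    simpa using Nat.card_le_card_of_injective _ hinj
  · intro d hd
    rcases h : ring d with _ | m
    · exact ⟨d, hd, h, Equiv.Perm.SameCycle.refl _ _⟩
    · have hm := hmk m
      rcases hring.1 h with ⟨j, hj, hj', rfl⟩ | rfl
      · by_cases hkj : k ∣ (j - 1)
        · have hjm : j = m * k + 1 := by
            by_contra hne
            exact hndvd (m := m) (j := j - 1) (by omega) (by omega) hkj
          subst hjm
          have hs : π.SameCycle (a (m * k + 1)) (c (m * k)) := Equiv.Perm.SameCycle.symm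
            ⟨1, by simpa using hπc (m * k) (by omega) (Dvd.intro_left _ rfl)⟩
          -- `c (m * k)` can belong to a ring only when it equals `a (m * k)`, as for K₂. Then the
          -- corner glued before it, `b (m * k - 1)`, is in no ring.
          rcases h' : ring (c (m * k)) with _ | n
          · exact ⟨_, hcO _, h', hs⟩
          · have hn := hmk n
            rcases hring.1 h' with ⟨i, hi, hi', h''⟩ | h''
            · have := hca (by omega) (by omega) h''
              subst this
              have hmpos : 1 ≤ (m : ℕ) := by
                rcases Nat.eq_zero_or_pos (m : ℕ) with h0 | h0
                · rw [h0] at hi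
                  omega
                · exact h0
              obtain ⟨m', hm'⟩ : ∃ m', (m : ℕ) = m' + 1 := ⟨m - 1, by omega⟩
              have hmm : (m : ℕ) * k = m' * k + k := by rw [hm', Nat.succ_mul]
              obtain ⟨d', h1, h2, h3⟩ := hpred (m * k) (by omega) (by omega)
                (hndvd (m := m') (by omega) (by omega))
              exact ⟨d', h1, h2, hs.trans (h'' ▸ h3)⟩
            · exact absurd h'' (hcb' (by omega) (by omega))
        · exact hpred j (by omega) (by omega) hkj
      · refine ⟨b N, hbO N, hring_bN, ?_⟩
        -- All corners `b (n * k)` form the hub, whose corner on the new outer face is `b N`.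
        have key : ∀ n, n ≤ s → π.SameCycle (b (n * k)) (b 0) := by
          intro n
          induction n with
          | zero => exact fun _ => by rw [zero_mul]
          | succ n ih =>
            intro hn
            refine Equiv.Perm.SameCycle.trans ⟨1, ?_⟩ (ih (by omega))
            rw [Nat.succ_mul]
            simpa using hπr ⟨n, hn⟩
        rw [hN]
        exact (key m m.2.le).trans (key s le_rfl).symm
  · intro P hPπ hPβ
    have key : ∀ j < t, P (a j) ↔ P (a 0) := by
      intro j
      induction j with
      | zero => exact fun _ => Iff.rfl
      | succ j ih =>
        intro hj
        rw [← ih (by omega)]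
        have h1 := hPπ (u (Sum.inl ⟨j, by omega⟩))
        rw [hπ] at h1
        by_cases hjN : j + 1 ≤ N
        · have h2 : β (u (Sum.inl ⟨j, by omega⟩)) = β (a j) := by
            simp only [u, Sum.elim_inl, if_pos hjN]
            split_ifs
            · rw [hβc, hβa']
            · rw [hβb, hβa']
          rw [← hPβ _ _ h2, ← h1]
          simp only [v, Sum.elim_inl, if_pos hjN]
        · have h2 : β (v (Sum.inl ⟨j, by omega⟩)) = β (a j) := by
            simp only [v, Sum.elim_inl, if_neg hjN]
            split_ifs with h
            · rw [hβb, hβa', h]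
            · rfl
          rw [← hPβ _ _ h2, h1]
          simp only [u, Sum.elim_inl, if_neg hjN]
    have key' : ∀ d, P d ↔ P (a 0) := by
      intro d
      rw [← key (β d) (β d).2]
      refine hPβ _ _ ?_
      rw [hβa']
      simp only [idx, dif_pos (β d).2]
    exact fun d d' => (key' d).trans (key' d').symm
  · intro γ J hγ hJ hconst m
    rcases m with _ | m
    · exact hγ
    by_contra hne0
    have hm := hmk m
    -- A block used only by ring m separates it from the outer face, where `γ` is 0, so it must
    -- belong to `J`.
    have hins : ∀ j, m * k < j → j < m * k + k → idx j ∈ J := by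
      intro j h1 h2
      by_contra hj
      have := hconst (a j) (haO j) (b j) (hbO j) (by rw [hβa', hβb]) (by rwa [hβa'])
      rw [hring_a m j h1 h2.le, hring_b' j (by omega) fun n hn =>
        hndvd h1 h2 (hn ▸ Dvd.intro_left _ rfl), hγ] at this
      exact hne0 this
    -- `h n` is the value on ring n for n < s, and `h s` is the outer value 0. Block n * k + k
    -- separates n from n + 1, and block 0 separates ring 0 from the outside, so a nonzero value on
    -- ring m needs a shared block in `J` on either side.
    let h : ℕ → ℚ := fun n => γ (ring (b (n * k)))
    have hh0 : idx 0 ∉ J → h 0 = 0 := by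
      intro h0
      have := hconst (a 0) (haO 0) (b 0) (hbO 0) (by rw [hβa', hβb]) (by rwa [hβa'])
      rw [hring_a0, hγ] at this
      simp only [h, zero_mul]
      exact this.symm
    have hhs : ∀ n < s, idx (n * k + k) ∉ J → h n = h (n + 1) := by
      intro n hn hnJ
      have := hconst _ (haO (n * k + k)) _ (hbO (n * k + k)) (by rw [hβa', hβb]) (by rwa [hβa'])
      rw [hring_a ⟨n, hn⟩ _ (by simp only; omega) le_rfl] at this
      simp only [h, Nat.succ_mul]
      rw [← this, ← hring_b ⟨n, hn⟩]
    have hhm : h m ≠ 0 := by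
      simp only [h, hring_b]
      exact hne0
    obtain ⟨m₁, hm₁, hm₁J⟩ : ∃ m₁ ≤ (m : ℕ), idx (m₁ * k) ∈ J := by
      by_contra! hcon
      have : ∀ n ≤ (m : ℕ), h n = 0 := by
        intro n
        induction n with
        | zero =>
          intro h0
          have := hcon 0 h0
          rw [zero_mul] at this
          exact hh0 this
        | succ n ih =>
          intro hn
          have := hcon _ hn
          rw [Nat.succ_mul] at this
          rw [← hhs n (by omega) this, ih (by omega)]
      exact hhm (this m le_rfl)
    obtain ⟨m₂, hm₂, hm₂s, hm₂J⟩ : ∃ m₂, (m : ℕ) ≤ m₂ ∧ m₂ < s ∧ idx (m₂ * k + k) ∈ J := by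
      by_contra! hcon
      have : ∀ n : ℕ, (m : ℕ) ≤ n → n ≤ s → h n = h m := by
        intro n hn
        induction n, hn using Nat.le_induction with
        | base => exact fun _ => rfl
        | succ n hn ih =>
          intro hns
          rw [← hhs n hns (hcon n hn hns), ih (by omega)]
      refine hhm ?_
      rw [← this s m.2.le le_rfl]
      simp only [h]
      rw [← hN, hring_bN, hγ]
    have hm₁k : m₁ * k ≤ m * k := Nat.mul_le_mul_right k hm₁
    have hm₂k : m * k ≤ m₂ * k := Nat.mul_le_mul_right k hm₂
    have hm₂N := hmk ⟨m₂, hm₂s⟩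
    simp only at hm₂N
    -- The k - 1 private blocks of ring m and one shared block on either side: k + 1 blocks in `J`,
    -- one too many.
    let T : Finset ℕ := insert (m₁ * k) (insert (m₂ * k + k) (Finset.Ioo (m * k) (m * k + k)))
    have hTcard : T.card = k + 1 := by
      rw [Finset.card_insert_of_notMem, Finset.card_insert_of_notMem, Nat.card_Ioo]
      · omega
      · simp only [Finset.mem_Ioo]
        omega
      · simp only [Finset.mem_insert, Finset.mem_Ioo]
        omega
    have hTlt : ∀ j ∈ T, j < t := by
      intro j hj
      simp only [T, Finset.mem_insert, Finset.mem_Ioo] at hj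
      omega
    have hTJ : T.image idx ⊆ J := by
      intro i hi
      obtain ⟨j, hj, rfl⟩ := Finset.mem_image.1 hi
      simp only [T, Finset.mem_insert, Finset.mem_Ioo] at hj
      rcases hj with rfl | rfl | ⟨h1, h2⟩
      exacts [hm₁J, hm₂J, hins j h1 h2]
    have := Finset.card_le_card hTJ
    rw [Finset.card_image_of_injOn fun i hi j hj hij => hidx (hTlt i hi) (hTlt j hj) hij] at this
    omega

theorem Equiv.Perm.exists_sameCycle_quotient {D : Type*} [Finite D] (ρ : Equiv.Perm D) :
    ∃ (n : ℕ) (q : D → Fin n), Function.Surjective q ∧ ∀ d d', q d = q d' ↔ ρ.SameCycle d d' := by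
  obtain ⟨n, ⟨e⟩⟩ := Finite.exists_equiv_fin (Quotient (Equiv.Perm.SameCycle.setoid ρ))
  refine ⟨n, fun d => e (Quotient.mk _ d), e.surjective.comp Quotient.mk_surjective, fun d d' => ?_⟩
  rw [e.injective.eq_iff]
  exact Quotient.eq

/-! ### The disjoint union of the blocks and the glued map. -/

namespace BlockGluing

/-- The darts of a disjoint union of graphs. -/
abbrev SDart {t : ℕ} {V : Fin t → Type*} (B : ∀ i, SimpleGraph (V i)) := (i : Fin t) × (B i).Dart

section Basic

variable {t : ℕ} {V : Fin t → Type*} {B : ∀ i, SimpleGraph (V i)}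

/-- The reversal of darts. -/
def flip (d : SDart B) : SDart B := ⟨d.1, d.2.symm⟩

theorem flip_flip : Function.Involutive (flip : SDart B → SDart B) := fun d => by
  simp [flip]

/-- The source of a dart. -/
def pt (d : SDart B) : (i : Fin t) × V i := ⟨d.1, d.2.fst⟩

/-- The edge of a dart. -/
def toEdge (d : SDart B) : (i : Fin t) × (B i).edgeSet := ⟨d.1, d.2.toEdge⟩

theorem toEdge_flip (d : SDart B) : toEdge (flip d) = toEdge d :=
  Sigma.ext rfl (heq_of_eq d.2.toEdge_symm)

theorem toEdge_surjective : Function.Surjective (toEdge : SDart B → _) := by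
  rintro ⟨i, e⟩
  obtain ⟨d, rfl⟩ := SimpleGraph.Dart.toEdge_surjective e
  exact ⟨⟨i, d⟩, rfl⟩

theorem pt_eq_iff {i : Fin t} {d d' : (B i).Dart} :
    pt (⟨i, d⟩ : SDart B) = pt ⟨i, d'⟩ ↔ d.fst = d'.fst := by
  simp [pt]

theorem pt_flip_ne (d : SDart B) : pt (flip d) ≠ pt d := by
  obtain ⟨i, d⟩ := d
  exact fun h => d.adj.ne (pt_eq_iff.1 h).symm

theorem eq_of_pt_eq {d d' : SDart B} (h : pt d = pt d') (h' : pt (flip d) = pt (flip d')) :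
    d = d' := by
  obtain ⟨i, d⟩ := d
  obtain ⟨j, d'⟩ := d'
  obtain rfl : i = j := congr_arg Sigma.fst h
  rw [SimpleGraph.Dart.ext d d' (Prod.ext (pt_eq_iff.1 h) (pt_eq_iff.1 h'))]

open Classical in
/-- The unit flow along a dart. -/
noncomputable def dartFlow (d : SDart B) : SDart B → ℚ := Pi.single d 1 - Pi.single (flip d) 1

theorem dartFlow_flip (d x : SDart B) : dartFlow d (flip x) = -dartFlow d x := by
  classical
  simp only [dartFlow, Pi.sub_apply, Pi.single_apply]
  have h1 : flip x = flip d ↔ x = d := flip_flip.injective.eq_iff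
  have h2 : flip x = d ↔ x = flip d := flip_flip.eq_iff
  simp only [h1, h2]
  ring

theorem eq_of_dartFlow_ne_zero {d x : SDart B} (h : dartFlow d x ≠ 0) : x.1 = d.1 := by
  classical
  simp only [dartFlow, Pi.sub_apply, Pi.single_apply] at h
  split_ifs at h with h1 h2 h2
  · rw [h1]
  · rw [h1]
  · rw [h2]
    rfl
  · simp at h

theorem sum_dartFlow_mul [Fintype (SDart B)] (d : SDart B) (κ : SDart B → ℚ) :
    ∑ x, dartFlow d x * κ x = κ d - κ (flip d) := by
  classical
  simp [dartFlow, sub_mul, Finset.sum_sub_distrib, Pi.single_apply]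

/-- A unit flow along a walk, with its divergence recorded by pairing with arbitrary vertex
functions. -/
theorem exists_flow_of_reachable [Fintype (SDart B)] {i : Fin t} {x y : V i}
    (h : (B i).Reachable x y) : ∃ c : SDart B → ℚ, (∀ d, c (flip d) = -c d) ∧
      (∀ d, c d ≠ 0 → d.1 = i) ∧
      ∀ κ : ((i : Fin t) × V i) → ℚ, ∑ d, c d * κ (pt d) = κ ⟨i, x⟩ - κ ⟨i, y⟩ := by
  obtain ⟨p⟩ := h
  induction p with
  | nil => exact ⟨0, by simp, by simp, by simp⟩
  | @cons u v w h p ih =>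
    obtain ⟨c, h1, h2, h3⟩ := ih
    let d₀ : SDart B := ⟨i, ⟨(u, v), h⟩⟩
    refine ⟨fun d => dartFlow d₀ d + c d, fun d => ?_, fun d hd => ?_, fun κ => ?_⟩
    · beta_reduce
      rw [dartFlow_flip, h1]
      ring
    · by_cases h0 : dartFlow d₀ d = 0
      · beta_reduce at hd
        rw [h0, zero_add] at hd
        exact h2 d hd
      · exact eq_of_dartFlow_ne_zero h0
    · simp only [add_mul, Finset.sum_add_distrib, h3, sum_dartFlow_mul d₀ fun d => κ (pt d)]
      have e1 : pt d₀ = ⟨i, u⟩ := rfl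
      have e2 : pt (flip d₀) = ⟨i, v⟩ := rfl
      rw [e1, e2]
      ring

end Basic

section Embedded

variable {t : ℕ} {V : Fin t → Type*} [∀ i, Fintype (V i)] {B : ∀ i, SimpleGraph (V i)}
  (E : ∀ i, OuterplaneEmbedding (B i))

/-- The rotation of the disjoint union. -/
def rot₀ : Equiv.Perm (SDart B) := Equiv.sigmaCongrRight fun i => (E i).rot

/-- The face permutation of the disjoint union. -/
def face₀ : Equiv.Perm (SDart B) := Equiv.sigmaCongrRight fun i => (E i).facePerm

/-- The darts on the outer faces of the blocks. -/
def Out : Set (SDart B) := {d | (E d.1).faceOf d.2 = (E d.1).outer}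

/-- The inner faces of the blocks. -/
abbrev InnerFace := (i : Fin t) × {F : (E i).Face // F ≠ (E i).outer}

/-- Every vertex lies only once on the outer face of its block. -/
def OuterSimple : Prop :=
  ∀ i d d', (E i).faceOf d = (E i).outer → (E i).faceOf d' = (E i).outer → d.fst = d'.fst → d = d'

variable {E}

theorem face₀_flip (d : SDart B) : face₀ E (flip d) = rot₀ E d :=
  Sigma.ext rfl (heq_of_eq ((E d.1).facePerm_symm_apply d.2))

theorem face₀_mem_out (d : SDart B) : face₀ E d ∈ Out E ↔ d ∈ Out E := by
  change (E d.1).faceOf ((E d.1).facePerm d.2) = _ ↔ _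
  rw [(E d.1).faceOf_facePerm]
  rfl

theorem pt_rot₀ (d : SDart B) : pt (rot₀ E d) = pt d :=
  Sigma.ext rfl (heq_of_eq ((E d.1).rot_fst d.2))

theorem pt_face₀ (d : SDart B) : pt (face₀ E d) = pt (flip d) :=
  Sigma.ext rfl (heq_of_eq ((E d.1).facePerm_fst d.2))

theorem OuterSimple.eq (hE : OuterSimple E) {d d' : SDart B} (h : d ∈ Out E) (h' : d' ∈ Out E)
    (hpt : pt d = pt d') : d = d' := by
  obtain ⟨i, d⟩ := d
  obtain ⟨j, d'⟩ := d'
  obtain rfl : i = j := congr_arg Sigma.fst hpt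
  rw [hE i d d' h h' (pt_eq_iff.1 hpt)]

theorem apply_eq_of_pt_eq {Y : Type*} {F : SDart B → Y} (hF : ∀ d, F (rot₀ E d) = F d)
    {d d' : SDart B} (h : pt d = pt d') : F d = F d' := by
  obtain ⟨i, d⟩ := d
  obtain ⟨j, d'⟩ := d'
  obtain rfl : i = j := congr_arg Sigma.fst h
  exact RotationSystem.apply_eq_of_fst_eq (E := (E i).toRotationSystem) (F := fun d => F ⟨i, d⟩)
    (fun d => hF ⟨i, d⟩) (pt_eq_iff.1 h)

/-- A function invariant under reversal and under the rotation except possibly when entering the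
outer face is constant on each block. -/
theorem OuterSimple.apply_eq_of_fst_eq (hE : OuterSimple E) {Y : Type*} {F : SDart B → Y}
    {i : Fin t} (hσ : ∀ d : SDart B, d.1 = i → F (flip d) = F d)
    (hF : ∀ d : SDart B, d.1 = i → rot₀ E d ∉ Out E → F (rot₀ E d) = F d) {d d' : SDart B}
    (h : d.1 = i) (h' : d'.1 = i) : F d = F d' := by
  obtain ⟨j, d⟩ := d
  obtain ⟨j', d'⟩ := d'
  obtain rfl : i = j := h.symm
  obtain rfl : i = j' := h'.symm
  refine RotationSystem.apply_eq_of_preconnected (E i).connected.preconnected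
    (E := (E i).toRotationSystem) (F := fun d => F ⟨i, d⟩) (fun d => ?_)
    (fun d => hσ ⟨i, d⟩ rfl) d d'
  refine Equiv.Perm.apply_eq_of_forall_not_mem (ρ := (E i).rot)
    (O := {d | (E i).faceOf d = (E i).outer}) (F := fun d => F ⟨i, d⟩)
    (fun d hd d' hd' hdd' => hE i d d' hd hd' ?_) (fun d hd => hF ⟨i, d⟩ rfl hd) d
  exact hdd'.apply_eq (F := fun d => d.fst) (E i).rot_fst

variable {k s : ℕ} (R : RingGluing (fun d : SDart B => d.1) (Out E) (face₀ E) k s)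

/-- The rotation of the glued map. -/
def rot : Equiv.Perm (SDart B) := R.π * rot₀ E

open Classical in
/-- The face of the glued map on which a dart lies; `none` stands for the outer face. -/
noncomputable def label (d : SDart B) : Option (InnerFace E ⊕ Fin s) :=
  if h : d ∈ Out E then (R.ring d).map Sum.inr else some (Sum.inl ⟨d.1, (E d.1).faceOf d.2, h⟩)

variable {R}

theorem label_of_mem {d : SDart B} (h : d ∈ Out E) : label R d = (R.ring d).map Sum.inr :=
  dif_pos h

theorem label_of_not_mem {d : SDart B} (h : d ∉ Out E) :
    label R d = some (Sum.inl ⟨d.1, (E d.1).faceOf d.2, h⟩) := dif_neg h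

theorem rot_flip (d : SDart B) : rot R (flip d) = R.π (face₀ E d) := by
  rw [rot, Equiv.Perm.mul_apply, ← face₀_flip, flip_flip]

theorem rot_of_not_mem {d : SDart B} (h : rot₀ E d ∉ Out E) : rot R d = rot₀ E d :=
  R.apply_of_not_mem _ h

theorem π_mem_out (d : SDart B) : R.π d ∈ Out E ↔ d ∈ Out E := by
  constructor <;> intro h <;> by_contra h'
  · rw [R.apply_of_not_mem d h'] at h
    exact h' h
  · rw [R.π.injective (R.apply_of_not_mem _ h')] at h'
    exact h' h

theorem label_rot_flip (d : SDart B) : label R (rot R (flip d)) = label R d := by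
  rw [rot_flip]
  by_cases h : d ∈ Out E
  · rw [label_of_mem h, label_of_mem ((π_mem_out _).2 ((face₀_mem_out _).2 h)), R.ring_apply]
  · have h' : face₀ E d ∉ Out E := fun h' => h ((face₀_mem_out _).1 h')
    rw [R.apply_of_not_mem _ h', label_of_not_mem h, label_of_not_mem h']
    congr 3
    exact Subtype.ext ((E d.1).faceOf_facePerm d.2)

theorem label_rot (d : SDart B) : label R (rot R d) = label R (flip d) := by
  rw [← label_rot_flip (flip d), flip_flip]

theorem ring_eq_some_iff {d : SDart B} {m : Fin s} :
    R.ring d = some m ↔ label R d = some (Sum.inr m) := by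
  by_cases h : d ∈ Out E
  · simp [label_of_mem h]
  · simp [label_of_not_mem h, R.ring_of_not_mem d h]

theorem label_surjective (hk : 0 < k) (m : InnerFace E ⊕ Fin s) : ∃ d, label R d = some m := by
  rcases m with ⟨i, F, hF⟩ | m
  · obtain ⟨d, rfl⟩ := (E i).faceOf_surjective F
    exact ⟨⟨i, d⟩, label_of_not_mem hF⟩
  · have : Nonempty {d // R.ring d = some m} :=
      (Nat.card_pos_iff.1 (hk.trans_le (R.le_card_ring m))).1
    obtain ⟨d, hd⟩ := this
    exact ⟨d, ring_eq_some_iff.1 hd⟩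

theorem label_eq_none_iff {d : SDart B} : label R d = none ↔ d ∈ Out E ∧ R.ring d = none := by
  by_cases h : d ∈ Out E
  · simp [label_of_mem h, h]
  · simp [label_of_not_mem h, h]

/-- The two rotations differ only when entering `Out E`, which each vertex of a block meets at most
once; by going round the vertex the exceptional step is harmless. -/
theorem invariant_rot₀ (hE : OuterSimple E) {Y : Type*} {F : SDart B → Y}
    (hF : ∀ d, F (rot R d) = F d) (d : SDart B) : F (rot₀ E d) = F d := by
  refine Equiv.Perm.apply_eq_of_forall_not_mem (O := Out E) (fun d hd d' hd' h => ?_)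
    (fun d hd => ?_) d
  · exact hE.eq hd hd' (h.apply_eq pt_rot₀)
  · rw [← hF d, rot_of_not_mem hd]

theorem invariant_π (hE : OuterSimple E) {Y : Type*} {F : SDart B → Y}
    (hF : ∀ d, F (rot R d) = F d) (d : SDart B) : F (R.π d) = F d := by
  obtain ⟨d, rfl⟩ := (rot₀ E).surjective d
  rw [invariant_rot₀ hE hF]
  exact hF d

/-- Connectedness of the glued map: each block is connected, and the pattern `R` connects the
blocks. -/
theorem apply_eq_of_invariant (hE : OuterSimple E) {Y : Type*} {F : SDart B → Y}
    (hF : ∀ d, F (rot R d) = F d) (hσ : ∀ d, F (flip d) = F d) (d d' : SDart B) : F d = F d' := by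
  refine ((R.iff_of_invariant (fun x => F x = F d) (fun x => ?_) (fun x x' h => ?_) d d').1
    rfl).symm
  · rw [invariant_π hE hF]
  · rw [hE.apply_eq_of_fst_eq (i := x.1) (F := F) (fun d _ => hσ d)
      (fun d _ _ => invariant_rot₀ hE hF d) rfl h.symm]

end Embedded

end BlockGluing

/-! ### Counting vertices and splitting circulations of the glued map. -/

namespace BlockGluing

variable {t : ℕ} {V : Fin t → Type*} [∀ i, Fintype (V i)] {B : ∀ i, SimpleGraph (V i)}
  {E : ∀ i, OuterplaneEmbedding (B i)} {k s : ℕ}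
  {R : RingGluing (fun d : SDart B => d.1) (Out E) (face₀ E) k s}

theorem pt_surjective (E : ∀ i, OuterplaneEmbedding (B i)) :
    Function.Surjective (pt : SDart B → (i : Fin t) × V i) := by
  rintro ⟨i, v⟩
  obtain ⟨d, -, rfl⟩ := (E i).exists_outer_dart v
  exact ⟨⟨i, d⟩, rfl⟩

theorem exists_label_eq_none (R : RingGluing (fun d : SDart B => d.1) (Out E) (face₀ E) k s)
    {d : SDart B} (hd : d ∈ Out E) :
    ∃ d', label R d' = none ∧ R.π.SameCycle d d' := by
  obtain ⟨d', h1, h2, h3⟩ := R.exists_ring_eq_none d hd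
  exact ⟨d', label_eq_none_iff.2 ⟨h1, h2⟩, h3⟩

theorem exists_outer_pt (E : ∀ i, OuterplaneEmbedding (B i)) (d : SDart B) :
    ∃ d' ∈ Out E, pt d' = pt d := by
  obtain ⟨i, d⟩ := d
  obtain ⟨d', h1, h2⟩ := (E i).exists_outer_dart d.fst
  exact ⟨⟨i, d'⟩, h1, pt_eq_iff.2 h2⟩

/-- A labelling of the vertices of the glued map. -/
structure VertexLabelling (R : RingGluing (fun d : SDart B => d.1) (Out E) (face₀ E) k s)
    (n : ℕ) where
  q : SDart B → Fin n
  surjective : Function.Surjective q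
  eq_iff : ∀ d d', q d = q d' ↔ (rot R).SameCycle d d'

variable {n : ℕ} (Q : VertexLabelling R n)

theorem q_rot (d : SDart B) : Q.q (rot R d) = Q.q d :=
  (Q.eq_iff _ _).2 (Equiv.Perm.SameCycle.symm ⟨1, by simp⟩)

theorem q_eq_of_pt_eq (hE : OuterSimple E) {d d' : SDart B} (h : pt d = pt d') :
    Q.q d = Q.q d' :=
  apply_eq_of_pt_eq (invariant_rot₀ hE (q_rot Q)) h

theorem q_eq_of_sameCycle (hE : OuterSimple E) {d d' : SDart B} (h : R.π.SameCycle d d') :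
    Q.q d = Q.q d' :=
  h.apply_eq (invariant_π hE (q_rot Q))

theorem exists_label_eq_none_of_vertex (hE : OuterSimple E) (w : Fin n) :
    ∃ d, label R d = none ∧ Q.q d = w := by
  obtain ⟨d, rfl⟩ := Q.surjective w
  obtain ⟨d₁, h₁, h₁'⟩ := exists_outer_pt E d
  obtain ⟨d₂, h₂, h₂'⟩ := exists_label_eq_none R h₁
  exact ⟨d₂, h₂, by rw [← q_eq_of_sameCycle Q hE h₂', q_eq_of_pt_eq Q hE h₁']⟩

/-- A function on the vertices of the blocks is determined by one value per glued vertex and the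
differences across the t - 1 + s pairs that generate the gluing. -/
theorem sum_card_le (Q : VertexLabelling R n) : ∑ i, Fintype.card (V i) ≤ n + (t - 1 + s) := by
  choose r hr using Q.surjective
  let Ψ : (((i : Fin t) × V i) → ℚ) →ₗ[ℚ] (Fin n → ℚ) × (Fin (t - 1) ⊕ Fin s → ℚ) :=
    { toFun := fun κ => (fun w => κ (pt (r w)), fun j => κ (pt (R.u j)) - κ (pt (R.v j)))
      map_add' := fun κ κ' => by
        ext <;> simp
        ring
      map_smul' := fun a κ => by
        ext <;> simp <;> ring }
  have hΨ : Function.Injective Ψ := by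
    rw [injective_iff_map_eq_zero]
    intro κ h0
    have h1 : ∀ w, κ (pt (r w)) = 0 := fun w => congr_fun (congr_arg Prod.fst h0) w
    have h2 : ∀ j, κ (pt (R.u j)) = κ (pt (R.v j)) := fun j =>
      sub_eq_zero.1 (congr_fun (congr_arg Prod.snd h0) j)
    have hrot : ∀ d, κ (pt (rot R d)) = κ (pt d) := by
      intro d
      rw [← pt_rot₀ (E := E) d]
      refine (R.apply_iff (fun x => κ (pt x) = κ (pt (rot₀ E d))) (fun j => ?_) _).2 rfl
      rw [h2]
    ext x
    obtain ⟨d, rfl⟩ := pt_surjective E x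
    rw [Pi.zero_apply, ← h1 (Q.q d)]
    exact ((Q.eq_iff _ _).1 (hr _).symm).apply_eq (F := fun d => κ (pt d)) hrot
  have := LinearMap.finrank_le_finrank_of_injective hΨ
  simp only [Module.finrank_prod, Module.finrank_fintype_fun_eq_card, Fintype.card_sigma,
    Fintype.card_sum, Fintype.card_fin] at this
  exact this

theorem natCard_sdart : Nat.card (SDart B) = 2 * Nat.card ((i : Fin t) × (B i).edgeSet) := by
  rw [Nat.card_sigma, Nat.card_sigma, Finset.mul_sum]
  exact Finset.sum_congr rfl fun i _ => SimpleGraph.natCard_dart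

theorem sum_card_add_card_innerFace :
    ∑ i, Fintype.card (V i) + Nat.card (InnerFace E) =
      Nat.card ((i : Fin t) × (B i).edgeSet) + t := by
  rw [Nat.card_sigma, Nat.card_sigma, ← Finset.sum_add_distrib]
  have : ∀ i, Fintype.card (V i) + Nat.card {F : (E i).Face // F ≠ (E i).outer} =
      Nat.card (B i).edgeSet + 1 := by
    intro i
    have h1 := (E i).euler
    have h2 : Nat.card {F : (E i).Face // F ≠ (E i).outer} + 1 = Nat.card (E i).Face := by
      rw [← Finite.card_option]
      classical
      exact Nat.card_congr (Equiv.optionSubtypeNe (E i).outer)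
    omega
  simp only [this, Finset.sum_add_distrib]
  simp

/-- The face permutation of the glued map. -/
def face (R : RingGluing (fun d : SDart B => d.1) (Out E) (face₀ E) k s) :
    Equiv.Perm (SDart B) := rot R * flip_flip.toPerm

theorem label_face (d : SDart B) : label R (face R d) = label R d := label_rot_flip d

theorem q_face (d : SDart B) : Q.q (face R d) = Q.q (flip d) := q_rot Q _

theorem eq_zero_of_flip_invariant (hE : OuterSimple E) (hk : 0 < k) (d₀ : SDart B)
    (g : Option (InnerFace E ⊕ Fin s) → ℚ) (hg : g none = 0)
    (hσ : ∀ d, g (label R (flip d)) = g (label R d)) (m : Option (InnerFace E ⊕ Fin s)) :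
    g m = 0 := by
  obtain ⟨d₁, h₁, -⟩ := exists_outer_pt E d₀
  obtain ⟨d₂, h₂, -⟩ := exists_label_eq_none R h₁
  have hall : ∀ d, g (label R d) = 0 := by
    intro d
    rw [← hg, ← h₂]
    exact apply_eq_of_invariant hE (F := fun d => g (label R d))
      (fun d => by rw [label_rot, hσ]) hσ d d₂
  rcases m with _ | m
  · exact hg
  · obtain ⟨d, hd⟩ := label_surjective hk m
    rw [← hd, hall]

theorem eq_zero_of_vertex_invariant (hE : OuterSimple E) (d₀ : SDart B) (f : Fin n → ℚ)
    (hσ : ∀ d, f (Q.q (flip d)) = f (Q.q d)) (h0 : f (Q.q d₀) = 0) (w : Fin n) : f w = 0 := by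
  obtain ⟨d, rfl⟩ := Q.surjective w
  rw [← h0]
  exact apply_eq_of_invariant hE (F := fun d => f (Q.q d)) (fun d => by rw [q_rot]) hσ d d₀

theorem card_add_card_le (Q : VertexLabelling R n) (hE : OuterSimple E) (hk : 0 < k) (d₀ : SDart B) :
    n + (Nat.card (InnerFace E) + s) ≤ 1 + Nat.card ((i : Fin t) × (B i).edgeSet) := by
  have := card_vertex_add_card_face_add_card_edge_le (σ := flip) (φ := face R)
    (p := Q.q) (L := label R) (edge := toEdge) (r := fun _ : Unit => Q.q d₀) flip_flip label_face
    (fun d _ => q_face Q d) toEdge_surjective toEdge_flip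
    (eq_zero_of_flip_invariant hE hk d₀)
    (fun f hf h0 => eq_zero_of_vertex_invariant Q hE d₀ f hf (h0 ()))
  rw [natCard_sdart, Nat.card_sum, Nat.card_fin, Nat.card_fin, Nat.card_unique (α := Unit)] at this
  omega

/-- The t - 1 + s pairs bound the loss of vertices from above and Euler's inequality bounds it from
below, and the two bounds agree. Genus zero of the glued map follows in `euler`. -/
theorem card_eq (Q : VertexLabelling R n) (hE : OuterSimple E) (hk : 0 < k) (d₀ : SDart B) :
    n + (t - 1 + s) = ∑ i, Fintype.card (V i) := by
  have h1 := card_add_card_le Q hE hk d₀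
  have h2 := sum_card_le Q
  have h3 := sum_card_add_card_innerFace (E := E)
  have h4 := d₀.1.pos
  omega

theorem euler (Q : VertexLabelling R n) (hE : OuterSimple E) (hk : 0 < k) (d₀ : SDart B) :
    n + (Nat.card (InnerFace E) + s) = 1 + Nat.card ((i : Fin t) × (B i).edgeSet) := by
  have h2 := card_eq Q hE hk d₀
  have h3 := sum_card_add_card_innerFace (E := E)
  have h4 := d₀.1.pos
  omega

theorem exists_boundary [Fintype (SDart B)] (hE : OuterSimple E) (hk : 0 < k) (d₀ : SDart B)
    (c : SDart B → ℚ) (hc : ∀ d, c (flip d) = -c d)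
    (hdiv : ∀ f : Fin n → ℚ, ∑ d, c d * f (Q.q d) = 0) :
    ∃ g : Option (InnerFace E ⊕ Fin s) → ℚ, g none = 0 ∧
      ∀ d, c d = g (label R d) - g (label R (flip d)) := by
  refine exists_boundary_eq_of_card_eq (σ := flip) (φ := face R)
    (p := Q.q) (L := label R) (edge := toEdge) (r := fun _ : Unit => Q.q d₀) flip_flip label_face
    (fun d _ => q_face Q d) toEdge_surjective toEdge_flip
    (eq_zero_of_flip_invariant hE hk d₀)
    (fun f hf h0 => eq_zero_of_vertex_invariant Q hE d₀ f hf (h0 ())) ?_ c hc hdiv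
  have := euler Q hE hk d₀
  rw [natCard_sdart, Nat.card_sum, Nat.card_fin, Nat.card_fin, Nat.card_unique (α := Unit)]
  omega

/-- A circulation of the glued graph meeting at most `k` blocks is a circulation in each block. -/
theorem sum_mul_pt_eq_zero [Fintype (SDart B)] (hE : OuterSimple E) (hk : 0 < k)
    (c : SDart B → ℚ) (hc : ∀ d, c (flip d) = -c d)
    (hdiv : ∀ f : Fin n → ℚ, ∑ d, c d * f (Q.q d) = 0) {J : Finset (Fin t)} (hJ : J.card ≤ k)
    (hcJ : ∀ d, c d ≠ 0 → d.1 ∈ J) (κ : ((i : Fin t) × V i) → ℚ) : ∑ d, c d * κ (pt d) = 0 := by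
  rcases isEmpty_or_nonempty (SDart B) with h | ⟨⟨d₀⟩⟩
  · exact Finset.sum_eq_zero fun d => isEmptyElim d
  obtain ⟨g, hg, hcg⟩ := exists_boundary Q hE hk d₀ c hc hdiv
  -- In a block outside `J` the flow is 0, so the potential does not change across edges and is
  -- constant on the block. The ring pattern then forces it to vanish on all rings.
  have hγ : ∀ m, g (Option.map Sum.inr m) = 0 := by
    refine R.eq_zero_of_card_le (fun m => g (m.map Sum.inr)) J hg hJ fun d hd d' hd' h hdJ => ?_
    rw [← label_of_mem hd, ← label_of_mem hd']
    have hflip : ∀ x : SDart B, x.1 = d.1 → g (label R (flip x)) = g (label R x) := by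
      intro x hx
      have : c x = 0 := by
        by_contra hne
        exact hdJ (hx ▸ hcJ x hne)
      linarith [hcg x]
    refine hE.apply_eq_of_fst_eq (F := fun d => g (label R d)) hflip (fun x hx hxO => ?_) rfl h.symm
    rw [← rot_of_not_mem (R := R) hxO, label_rot, hflip x hx]
  have hout : ∀ d ∈ Out E, g (label R d) = 0 := fun d hd => by rw [label_of_mem hd, hγ]
  -- With the rings at potential 0, like the outer face, `g` is a face potential for the separate
  -- blocks, so the flow is already conserved there.
  have hface : ∀ d, g (label R (face₀ E d)) = g (label R d) := by
    intro d
    by_cases hd : d ∈ Out E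
    · rw [hout d hd, hout _ ((face₀_mem_out _).2 hd)]
    · rw [← label_rot_flip d, rot_flip, R.apply_of_not_mem _ (fun h => hd ((face₀_mem_out _).1 h))]
  have h1 : ∑ d, g (label R (flip d)) * κ (pt d) = ∑ d, g (label R d) * κ (pt d) := by
    rw [← Equiv.sum_comp (rot₀ E) fun d => g (label R d) * κ (pt d)]
    refine Finset.sum_congr rfl fun d _ => ?_
    rw [pt_rot₀, ← face₀_flip, hface]
  simp only [hcg, sub_mul, Finset.sum_sub_distrib, h1, sub_self]

/-- A path in a block between two identified vertices would be a circulation of the glued map inside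
one block, hence a circulation of that block, so its ends agree. -/
theorem pt_eq_of_q_eq (hE : OuterSimple E) (hk : 0 < k) {d d' : SDart B} (h : Q.q d = Q.q d')
    (h1 : d.1 = d'.1) : pt d = pt d' := by
  classical
  cases nonempty_fintype (SDart B)
  obtain ⟨i, d⟩ := d
  obtain ⟨j, d'⟩ := d'
  obtain rfl : i = j := h1
  obtain ⟨c, hc, hci, hcκ⟩ := exists_flow_of_reachable
    ((E i).connected.preconnected d.fst d'.fst)
  have := sum_mul_pt_eq_zero Q hE hk c hc (fun f => ?_) (J := {i})
    (by rwa [Finset.card_singleton])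
    (fun x hx => Finset.mem_singleton.2 (hci x hx)) (fun x => if x = ⟨i, d.fst⟩ then (1 : ℚ) else 0)
  · rw [hcκ fun x => if x = ⟨i, d.fst⟩ then (1 : ℚ) else 0, if_pos rfl] at this
    by_contra hne
    rw [if_neg (fun h => hne h.symm)] at this
    norm_num at this
  · choose r hr using pt_surjective E
    have hq : ∀ x, Q.q (r (pt x)) = Q.q x := fun x => q_eq_of_pt_eq Q hE (hr _)
    have := hcκ fun x => f (Q.q (r x))
    simp only [hq] at this
    rw [this]
    have e1 := hq ⟨i, d⟩
    have e2 := hq ⟨i, d'⟩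
    simp only [pt] at e1 e2
    rw [e1, e2, h, sub_self]

theorem q_flip_ne (hE : OuterSimple E) (hk : 0 < k) (d : SDart B) : Q.q (flip d) ≠ Q.q d :=
  fun h => pt_flip_ne d (pt_eq_of_q_eq Q hE hk h rfl)

/-- Two parallel darts differ by a circulation meeting at most two blocks; being conserved in each
block, it forces the darts into the same block. -/
theorem eq_of_q_eq (hE : OuterSimple E) (hk : 2 ≤ k) {d d' : SDart B} (h : Q.q d = Q.q d')
    (h' : Q.q (flip d) = Q.q (flip d')) : d = d' := by
  classical
  cases nonempty_fintype (SDart B)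
  have key := sum_mul_pt_eq_zero Q hE (by omega) (fun x => dartFlow d x - dartFlow d' x)
    (fun x => by rw [dartFlow_flip, dartFlow_flip]; ring) (fun f => ?_) (J := {d.1, d'.1})
    (Finset.card_le_two.trans hk) (fun x hx => ?_) (fun x => if x = pt d then 1 else 0)
  · simp only [sub_mul, Finset.sum_sub_distrib] at key
    rw [sum_dartFlow_mul d fun x => if pt x = pt d then (1 : ℚ) else 0,
      sum_dartFlow_mul d' fun x => if pt x = pt d then (1 : ℚ) else 0, if_pos rfl,
      if_neg (pt_flip_ne d)] at key
    have hpt : pt d' = pt d := by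
      by_contra hne
      rw [if_neg hne] at key
      split_ifs at key <;> norm_num at key
    have h1 : d.1 = d'.1 := congr_arg (fun x : (i : Fin t) × V i => x.1) hpt.symm
    exact eq_of_pt_eq hpt.symm (pt_eq_of_q_eq Q hE (by omega) h' h1)
  · simp only [sub_mul, Finset.sum_sub_distrib]
    rw [sum_dartFlow_mul d fun x => f (Q.q x), sum_dartFlow_mul d' fun x => f (Q.q x), h, h',
      sub_self]
  · by_cases h0 : dartFlow d x = 0
    · have h0' : dartFlow d' x ≠ 0 := fun h0' => hx (by rw [h0, h0', sub_self])
      simp [eq_of_dartFlow_ne_zero h0']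
    · simp [eq_of_dartFlow_ne_zero h0]

/-- A cycle of length `k` of the glued graph lies in one block. -/
theorem exists_block_of_cycle (hE : OuterSimple E) {m : ℕ} (hk : m + 2 ≤ k)
    (δ : Fin (m + 2) → SDart B) (hδ : ∀ i, Q.q (flip (δ i)) = Q.q (δ (i + 1)))
    (hinj : Function.Injective fun i => Q.q (δ i)) :
    ∀ i, pt (δ (i + 1)) = pt (flip (δ i)) := by
  classical
  cases nonempty_fintype (SDart B)
  intro i
  have key := sum_mul_pt_eq_zero Q hE (by omega) (fun x => ∑ j, dartFlow (δ j) x)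
    (fun x => by simp only [dartFlow_flip, Finset.sum_neg_distrib]) (fun f => ?_)
    (J := Finset.univ.image fun j => (δ j).1) (Finset.card_image_le.trans (by simpa using hk))
    (fun x hx => ?_) (fun x => if x = pt (flip (δ i)) then 1 else 0)
  · simp only [Finset.sum_mul] at key
    rw [Finset.sum_comm] at key
    simp only [fun j => sum_dartFlow_mul (δ j)
      fun x => if pt x = pt (flip (δ i)) then (1 : ℚ) else 0, Finset.sum_sub_distrib] at key
    -- Tested at the end of `δ i` in its own block, only `δ i` flows in, so some dart of the cycle
    -- must leave from that very point, and it can only be `δ (i + 1)`.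
    have h1 : ∀ j, (if pt (flip (δ j)) = pt (flip (δ i)) then (1 : ℚ) else 0) =
        if j = i then 1 else 0 := by
      intro j
      refine if_congr ⟨fun h => ?_, fun h => by rw [h]⟩ rfl rfl
      have := q_eq_of_pt_eq Q hE h
      rw [hδ, hδ] at this
      exact add_right_cancel (hinj this)
    rw [Finset.sum_congr rfl fun j _ => h1 j, Finset.sum_ite_eq' Finset.univ i,
      if_pos (Finset.mem_univ i)] at key
    by_contra hne
    rw [Finset.sum_eq_zero] at key
    · norm_num at key
    · intro j _
      refine if_neg fun h => ?_
      have := q_eq_of_pt_eq Q hE h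
      rw [hδ] at this
      exact hne (hinj this ▸ h)
  · simp only [Finset.sum_mul]
    rw [Finset.sum_comm]
    simp only [fun j => sum_dartFlow_mul (δ j) fun x => f (Q.q x), Finset.sum_sub_distrib, hδ]
    rw [sub_eq_zero]
    exact (Equiv.sum_comp (Equiv.addRight (1 : Fin (m + 2))) fun j => f (Q.q (δ j))).symm
  · obtain ⟨j, -, hj⟩ := Finset.exists_ne_zero_of_sum_ne_zero hx
    rw [Finset.mem_image]
    exact ⟨j, Finset.mem_univ j, (eq_of_dartFlow_ne_zero hj).symm⟩

end BlockGluing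

/-! ### The glued graph, its embedding and its k-blocks. -/

/-- A planar map given by darts, a reversal and a rotation, in which every vertex lies on the
outer face, yields an outerplane embedding. -/
theorem exists_outerplaneEmbedding_of_labelling {D S : Type*} [Finite D] [Finite S] {n : ℕ}
    {G : SimpleGraph (Fin n)} (hG : G.Connected) (e : D ≃ G.Dart) {σ : D → D} {ρ : Equiv.Perm D}
    (hσ : ∀ d, e (σ d) = (e d).symm) (hρ : ∀ d d', (e d).fst = (e d').fst ↔ ρ.SameCycle d d')
    {L : D → Option S} (hL : ∀ d, L (ρ (σ d)) = L d) (hsurj : ∀ m, ∃ d, L d = some m)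
    (hout : ∀ w, ∃ d, L d = none ∧ (e d).fst = w)
    (heuler : n + Nat.card S = Nat.card G.edgeSet + 1) :
    ∃ E : OuterplaneEmbedding G,
      (∀ d d', E.faceOf (e d) = E.faceOf (e d') ↔ L d = L d') ∧
      ∀ d, E.faceOf (e d) = E.outer ↔ L d = none := by
  obtain ⟨w⟩ := hG.nonempty
  obtain ⟨d₀, hd₀, -⟩ := hout w
  have hpow : ∀ (i : ℕ) d, ((e.permCongr ρ) ^ i) (e d) = e ((ρ ^ i) d) := by
    intro i d
    induction i with
    | zero => rfl
    | succ i ih => rw [pow_succ', pow_succ', Equiv.Perm.mul_apply, ih, Equiv.Perm.mul_apply,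
        Equiv.permCongr_apply, Equiv.symm_apply_apply]
  let R : RotationSystem G :=
    { rot := e.permCongr ρ
      rot_fst := fun d => by
        obtain ⟨d, rfl⟩ := e.surjective d
        rw [Equiv.permCongr_apply, Equiv.symm_apply_apply, hρ]
        exact Equiv.Perm.SameCycle.symm ⟨1, by simp⟩
      rot_cyclic := fun d d' h => by
        obtain ⟨d, rfl⟩ := e.surjective d
        obtain ⟨d', rfl⟩ := e.surjective d'
        obtain ⟨i, hi⟩ := ((hρ d d').1 h).exists_nat_pow_eq
        exact ⟨i, by rw [zpow_natCast, hpow, hi]⟩ }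
  have hface : ∀ d, R.facePerm (e d) = e (ρ (σ d)) := by
    intro d
    rw [R.facePerm_apply, ← hσ]
    change e.permCongr ρ (e (σ d)) = _
    rw [Equiv.permCongr_apply, Equiv.symm_apply_apply]
  have hinv : ∀ x, L (e.symm (R.facePerm x)) = L (e.symm x) := by
    intro x
    obtain ⟨d, rfl⟩ := e.surjective x
    rw [hface, Equiv.symm_apply_apply, hL, Equiv.symm_apply_apply]
  let Λ : R.Face → Option S := Quotient.lift (fun x => L (e.symm x)) fun x y h =>
    Equiv.Perm.SameCycle.apply_eq (F := fun x => L (e.symm x)) hinv h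
  have hΛ : ∀ d, Λ (R.faceOf (e d)) = L d := by
    intro d
    change L (e.symm (e d)) = L d
    rw [Equiv.symm_apply_apply]
  have hΛs : Function.Surjective Λ := by
    rintro (_ | m)
    · exact ⟨_, (hΛ d₀).trans hd₀⟩
    · obtain ⟨d, hd⟩ := hsurj m
      exact ⟨_, (hΛ d).trans hd⟩
  -- Every label occurs, so there are at least |S| + 1 faces; Euler's inequality allows no more, so
  -- labels and faces correspond bijectively.
  have hle := RotationSystem.card_add_card_face_le (E := R) hG (e d₀)
  rw [Nat.card_fin] at hle
  have hcard : Nat.card R.Face = Nat.card S + 1 := by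
    have := Nat.card_le_card_of_surjective _ hΛs
    rw [Finite.card_option] at this
    omega
  have hbij := hΛs.bijective_of_nat_card_le (by rw [Finite.card_option, hcard])
  have hiff : ∀ d d', R.faceOf (e d) = R.faceOf (e d') ↔ L d = L d' := by
    intro d d'
    rw [← hbij.1.eq_iff, hΛ, hΛ]
  refine ⟨{ toRotationSystem := R
            connected := hG
            euler := by rw [Fintype.card_fin, hcard]; omega
            outer := R.faceOf (e d₀)
            vertexOn_outer := fun w => ?_ }, hiff, fun d => by rw [← hd₀]; exact hiff d d₀⟩
  obtain ⟨d, hd, hw⟩ := hout w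
  exact ⟨e d, (hiff d d₀).2 (hd.trans hd₀.symm), hw⟩

namespace BlockGluing

variable {t : ℕ} {V : Fin t → Type*} [∀ i, Fintype (V i)] {B : ∀ i, SimpleGraph (V i)}
  {E : ∀ i, OuterplaneEmbedding (B i)} {k s : ℕ}
  {R : RingGluing (fun d : SDart B => d.1) (Out E) (face₀ E) k s} {n : ℕ}
  (Q : VertexLabelling R n)

/-- The glued graph. -/
def graph (hE : OuterSimple E) (hk : 0 < k) : SimpleGraph (Fin n) where
  Adj v w := ∃ d, Q.q d = v ∧ Q.q (flip d) = w
  symm := ⟨by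
    rintro v w ⟨d, rfl, rfl⟩
    exact ⟨flip d, rfl, by rw [flip_flip d]⟩⟩
  loopless := ⟨by
    rintro v ⟨d, rfl, h⟩
    exact q_flip_ne Q hE hk d h⟩

/-- The darts of the glued graph. -/
noncomputable def dartEquiv (hE : OuterSimple E) (hk : 2 ≤ k) :
    SDart B ≃ (graph Q hE (by omega : 0 < k)).Dart :=
  Equiv.ofBijective (fun d => ⟨(Q.q d, Q.q (flip d)), d, rfl, rfl⟩) <| by
    constructor
    · intro d d' h
      have h' := congr_arg SimpleGraph.Dart.toProd h
      exact eq_of_q_eq Q hE hk (congr_arg Prod.fst h') (congr_arg Prod.snd h')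
    · rintro ⟨⟨v, w⟩, d, h, h'⟩
      exact ⟨d, SimpleGraph.Dart.ext _ _ (Prod.ext h h')⟩

section Graph

variable {Q} (hE : OuterSimple E) (hk : 2 ≤ k)

theorem dartEquiv_flip (d : SDart B) :
    dartEquiv Q hE hk (flip d) = (dartEquiv Q hE hk d).symm :=
  SimpleGraph.Dart.ext _ _ (Prod.ext rfl (congr_arg Q.q (flip_flip d)))

theorem dartEquiv_toEdge_flip (d : SDart B) :
    (dartEquiv Q hE hk (flip d)).toEdge = (dartEquiv Q hE hk d).toEdge := by
  rw [dartEquiv_flip, SimpleGraph.Dart.toEdge_symm]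

theorem graph_connected (d₀ : SDart B) : (graph Q hE (by omega : 0 < k)).Connected := by
  have key : ∀ d d', (graph Q hE (by omega : 0 < k)).Reachable (Q.q d) (Q.q d') := by
    intro d d'
    refine (apply_eq_of_invariant (R := R) hE
      (F := fun x => (graph Q hE (by omega : 0 < k)).Reachable (Q.q d) (Q.q x))
      (fun x => by rw [q_rot]) (fun x => propext ?_) d d').mp (SimpleGraph.Reachable.refl _)
    have hadj : (graph Q hE (by omega : 0 < k)).Adj (Q.q x) (Q.q (flip x)) := ⟨x, rfl, rfl⟩
    exact ⟨fun h => h.trans hadj.symm.reachable, fun h => h.trans hadj.reachable⟩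
  refine (SimpleGraph.connected_iff _).2 ⟨fun v w => ?_, ⟨Q.q d₀⟩⟩
  obtain ⟨d, rfl⟩ := Q.surjective v
  obtain ⟨d', rfl⟩ := Q.surjective w
  exact key d d'

theorem natCard_edgeSet :
    Nat.card (graph Q hE (by omega : 0 < k)).edgeSet = Nat.card ((i : Fin t) × (B i).edgeSet) := by
  have h1 := (graph Q hE (by omega : 0 < k)).natCard_dart
  have h2 := natCard_sdart (B := B)
  have h3 := Nat.card_congr (dartEquiv Q hE hk)
  omega

theorem graph_free (hk3 : 3 ≤ k) (hfree : ∀ i, (SimpleGraph.cycleGraph k).Free (B i)) :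
    (SimpleGraph.cycleGraph k).Free (graph Q hE (by omega : 0 < k)) := by
  rintro ⟨⟨f, hf⟩⟩
  obtain ⟨m, rfl⟩ : ∃ m, k = m + 2 := ⟨k - 2, by omega⟩
  have hadj : ∀ i : Fin (m + 2), ∃ d, Q.q d = f i ∧ Q.q (flip d) = f (i + 1) := fun i =>
    f.map_adj (SimpleGraph.cycleGraph_adj.2 (Or.inr (add_sub_cancel_left i 1)))
  choose δ hδ hδ' using hadj
  have hq : Function.Injective fun i => Q.q (δ i) := by
    intro i j hij
    simp only [hδ] at hij
    exact hf hij
  have hpt := exists_block_of_cycle Q hE le_rfl δ (fun i => by rw [hδ', hδ]) hq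
  have hblock : ∀ i, (δ i).1 = (δ 0).1 := by
    have key : ∀ j : ℕ, (δ (Fin.ofNat (m + 2) j)).1 = (δ 0).1 := by
      intro j
      induction j with
      | zero => rfl
      | succ j ih =>
        have hj : Fin.ofNat (m + 2) (j + 1) = Fin.ofNat (m + 2) j + 1 :=
          Fin.ext (by simp [Fin.val_add])
        rw [hj, ← ih]
        exact congr_arg (fun x : (i : Fin t) × V i => x.1) (hpt (Fin.ofNat (m + 2) j))
    intro i
    have := key i
    rwa [Fin.ofNat_val_eq_self] at this
  generalize (δ 0).1 = b at hblock
  have hex : ∀ i, ∃ d : (B b).Dart, δ i = ⟨b, d⟩ := by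
    intro i
    have := hblock i
    generalize δ i = x at this
    obtain ⟨b', d⟩ := x
    obtain rfl : b = b' := this.symm
    exact ⟨d, rfl⟩
  choose d hd using hex
  have hsucc : ∀ i, (d (i + 1)).fst = (d i).snd := by
    intro i
    have := hpt i
    rw [hd, hd] at this
    exact pt_eq_iff.1 this
  have hAdj : ∀ i, (B b).Adj (d i).fst (d (i + 1)).fst := by
    intro i
    rw [hsucc]
    exact (d i).adj
  refine hfree b ⟨⟨⟨fun i => (d i).fst, fun {i j} hij => ?_⟩, fun i j hij => hq ?_⟩⟩
  · rcases SimpleGraph.cycleGraph_adj.1 hij with h | h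
    · rw [sub_eq_iff_eq_add'.1 h]
      exact (hAdj j).symm
    · rw [sub_eq_iff_eq_add'.1 h]
      exact hAdj i
  · refine q_eq_of_pt_eq Q hE ?_
    rw [hd, hd]
    exact pt_eq_iff.2 hij

theorem exists_embedding (d₀ : SDart B) :
    ∃ E' : OuterplaneEmbedding (graph Q hE (by omega : 0 < k)),
      (∀ d d', E'.faceOf (dartEquiv Q hE hk d) = E'.faceOf (dartEquiv Q hE hk d') ↔
        label R d = label R d') ∧
      ∀ d, E'.faceOf (dartEquiv Q hE hk d) = E'.outer ↔ label R d = none := by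
  refine exists_outerplaneEmbedding_of_labelling (graph_connected hE hk d₀) (dartEquiv Q hE hk)
    (σ := flip) (ρ := rot R) (dartEquiv_flip hE hk) (fun d d' => Q.eq_iff d d') label_rot_flip
    (label_surjective (by omega)) (exists_label_eq_none_of_vertex Q hE) ?_
  have := euler Q hE (by omega) d₀
  rw [natCard_edgeSet hE hk, Nat.card_sum, Nat.card_fin]
  omega

end Graph

/-- An outerplane embedding of the glued graph with the expected faces. -/
structure GluedEmbedding (hE : OuterSimple E) (hk : 2 ≤ k) where
  emb : OuterplaneEmbedding (graph Q hE (by omega : 0 < k))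
  faceOf_eq_iff : ∀ d d', emb.faceOf (dartEquiv Q hE hk d) = emb.faceOf (dartEquiv Q hE hk d') ↔
    label R d = label R d'
  faceOf_eq_outer_iff : ∀ d, emb.faceOf (dartEquiv Q hE hk d) = emb.outer ↔ label R d = none

variable {Q} {hE : OuterSimple E} {hk : 2 ≤ k} (M : GluedEmbedding Q hE hk)

theorem faceSize_eq (d : SDart B) : M.emb.faceSize (M.emb.faceOf (dartEquiv Q hE hk d)) =
    Nat.card {d' // label R d' = label R d} :=
  (Nat.card_congr ((dartEquiv Q hE hk).subtypeEquiv fun d' => (M.faceOf_eq_iff d' d).symm)).symm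

/-- Rings have length at least k, so gluing creates no new small face, and the inner faces of the
blocks do not grow. -/
theorem isSmallInnerFace_iff (hsmall : ∀ i F, F ≠ (E i).outer → (E i).faceSize F < k)
    (d : SDart B) :
    M.emb.IsSmallInnerFace k (M.emb.faceOf (dartEquiv Q hE hk d)) ↔ d ∉ Out E := by
  rw [OuterplaneEmbedding.IsSmallInnerFace, faceSize_eq, Ne, M.faceOf_eq_outer_iff]
  constructor
  · rintro ⟨h1, h2⟩ hd
    rw [label_eq_none_iff, not_and] at h1
    obtain ⟨m, hm⟩ := Option.ne_none_iff_exists'.1 (h1 hd)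
    rw [ring_eq_some_iff.1 hm] at h2
    have := R.le_card_ring m
    simp only [ring_eq_some_iff] at this
    omega
  · intro hd
    refine ⟨fun h => hd (label_eq_none_iff.1 h).1, ?_⟩
    refine lt_of_le_of_lt ?_ (hsmall d.1 _ hd)
    have hmem : ∀ d' : {d' // label R d' = label R d}, ∃ x : (B d.1).Dart,
        d'.1 = ⟨d.1, x⟩ ∧ (E d.1).faceOf x = (E d.1).faceOf d.2 := by
      rintro ⟨d', h⟩
      have hd' : d' ∉ Out E := by
        intro h'
        rw [label_of_not_mem hd, label_of_mem h'] at h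
        cases h0 : R.ring d' <;> simp [h0] at h
      rw [label_of_not_mem hd, label_of_not_mem hd', Option.some.injEq, Sum.inl.injEq] at h
      obtain ⟨i, d⟩ := d
      obtain ⟨j, d'⟩ := d'
      obtain rfl : i = j := (congr_arg (fun x : InnerFace E => x.1) h).symm
      refine ⟨d', rfl, ?_⟩
      exact congr_arg Subtype.val (eq_of_heq (Sigma.mk.inj h).2)
    choose x hx hx' using hmem
    refine Nat.card_le_card_of_injective (fun d' => ⟨x d', hx' d'⟩) fun a b hab => Subtype.ext ?_
    have h0 : x a = x b := Subtype.ext_iff.1 hab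
    rw [hx, hx, h0]

theorem fst_eq_of_label_eq {d d' : SDart B} (hd : d ∉ Out E) (hd' : d' ∉ Out E)
    (h : label R d = label R d') : d.1 = d'.1 := by
  rw [label_of_not_mem hd, label_of_not_mem hd', Option.some.injEq, Sum.inl.injEq] at h
  exact congr_arg (fun x : InnerFace E => x.1) h

/-- A small face stays inside one block. Conversely, around a vertex of a block all corners but one
lie on inner faces, so the edges of a block are joined through small faces. -/
theorem faceConnected_iff (hsmall : ∀ i F, F ≠ (E i).outer → (E i).faceSize F < k)
    (d d' : SDart B) :
    M.emb.FaceConnected k (dartEquiv Q hE hk d).toEdge (dartEquiv Q hE hk d').toEdge ↔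
      d.1 = d'.1 := by
  constructor
  · intro h
    have := h.apply_eq (F := fun x => ((dartEquiv Q hE hk).symm x).1) (fun x => ?_) fun x hx => ?_
    · simpa using this
    · obtain ⟨x, rfl⟩ := (dartEquiv Q hE hk).surjective x
      rw [← dartEquiv_flip, Equiv.symm_apply_apply, Equiv.symm_apply_apply]
      rfl
    · obtain ⟨y, hy⟩ := (dartEquiv Q hE hk).surjective (M.emb.facePerm x)
      obtain ⟨x, rfl⟩ := (dartEquiv Q hE hk).surjective x
      have h1 := M.emb.faceOf_facePerm (dartEquiv Q hE hk x)
      rw [← hy] at h1 ⊢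
      rw [Equiv.symm_apply_apply, Equiv.symm_apply_apply]
      exact fst_eq_of_label_eq ((isSmallInnerFace_iff M hsmall y).1 (h1 ▸ hx))
        ((isSmallInnerFace_iff M hsmall x).1 hx) ((M.faceOf_eq_iff y x).1 h1)
  · intro h
    refine (hE.apply_eq_of_fst_eq (i := d.1) (F := fun x => M.emb.FaceConnected k
      (dartEquiv Q hE hk d).toEdge (dartEquiv Q hE hk x).toEdge) (fun x _ => ?_)
      (fun x _ hx => ?_) rfl h.symm).mp Relation.ReflTransGen.refl
    · rw [dartEquiv_toEdge_flip]
    · have hx' : flip x ∉ Out E := by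
        rwa [← face₀_flip, face₀_mem_out] at hx
      have hstep : M.emb.FaceConnected k (dartEquiv Q hE hk x).toEdge
          (dartEquiv Q hE hk (rot₀ E x)).toEdge := by
        rw [← dartEquiv_toEdge_flip]
        refine Relation.ReflTransGen.single ⟨_, (isSmallInnerFace_iff M hsmall _).2 hx',
          ⟨_, rfl, rfl⟩, ⟨_, ?_, rfl⟩⟩
        rw [M.faceOf_eq_iff, ← rot_of_not_mem (R := R) hx, label_rot]
      exact propext ⟨fun h' => h'.trans hstep.symm, fun h' => h'.trans hstep⟩

theorem exists_blocks_equiv (hsmall : ∀ i F, F ≠ (E i).outer → (E i).faceSize F < k) :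
    ∃ f : Fin t ≃ M.emb.kBlocks k, ∀ d : SDart B,
      (f d.1 : SimpleGraph.Subgraph _) = M.emb.kBlock k (dartEquiv Q hE hk d).toEdge := by
  have hex : ∀ i, ∃ d : SDart B, d.1 = i := fun i => by
    obtain ⟨v⟩ := (E i).connected.nonempty
    obtain ⟨d, -⟩ := (E i).exists_outer_dart v
    exact ⟨⟨i, d⟩, rfl⟩
  choose b hb using hex
  refine ⟨Equiv.ofBijective
    (fun i => ⟨M.emb.kBlock k (dartEquiv Q hE hk (b i)).toEdge, _, rfl⟩) ⟨?_, ?_⟩, fun d => ?_⟩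
  · intro i j hij
    have := (faceConnected_iff M hsmall _ _).1
      (OuterplaneEmbedding.kBlock_eq_iff.1 (Subtype.ext_iff.1 hij))
    rwa [hb, hb] at this
  · rintro ⟨_, e, rfl⟩
    obtain ⟨x, rfl⟩ := SimpleGraph.Dart.toEdge_surjective e
    obtain ⟨d, rfl⟩ := (dartEquiv Q hE hk).surjective x
    exact ⟨d.1, Subtype.ext (OuterplaneEmbedding.kBlock_eq_iff.2
      ((faceConnected_iff M hsmall _ _).2 (hb _)))⟩
  · exact OuterplaneEmbedding.kBlock_eq_iff.2 ((faceConnected_iff M hsmall _ _).2 (hb _))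

theorem nonempty_iso_kBlock (hsmall : ∀ i F, F ≠ (E i).outer → (E i).faceSize F < k)
    (d₀ : SDart B) :
    Nonempty (B d₀.1 ≃g (M.emb.kBlock k (dartEquiv Q hE hk d₀).toEdge).coe) := by
  obtain ⟨i, x₀⟩ := d₀
  have hex : ∀ v : V i, ∃ d : (B i).Dart, d.fst = v := fun v => by
    obtain ⟨d, -, hd⟩ := (E i).exists_outer_dart v
    exact ⟨d, hd⟩
  choose r hr using hex
  let μ : V i → Fin n := fun v => Q.q ⟨i, r v⟩
  have hμ : ∀ d : (B i).Dart, Q.q ⟨i, d⟩ = μ d.fst := fun d =>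
    q_eq_of_pt_eq Q hE (pt_eq_iff.2 (hr _).symm)
  have hμ' : ∀ d : (B i).Dart, Q.q (flip ⟨i, d⟩) = μ d.snd := fun d => hμ d.symm
  have hinj : Function.Injective μ := by
    intro v w hvw
    have := pt_eq_iff.1 (pt_eq_of_q_eq Q hE (by omega) hvw rfl)
    rwa [hr, hr] at this
  have hconn : ∀ d : (B i).Dart, M.emb.FaceConnected k (dartEquiv Q hE hk ⟨i, x₀⟩).toEdge
      (dartEquiv Q hE hk ⟨i, d⟩).toEdge := fun d => (faceConnected_iff M hsmall _ _).2 rfl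
  have hconn' : ∀ e : (graph Q hE (by omega : 0 < k)).edgeSet,
      M.emb.FaceConnected k (dartEquiv Q hE hk ⟨i, x₀⟩).toEdge e →
      ∃ d : (B i).Dart, (e : Sym2 (Fin n)) = s(μ d.fst, μ d.snd) := by
    intro e he
    obtain ⟨x, rfl⟩ := SimpleGraph.Dart.toEdge_surjective e
    obtain ⟨⟨j, d⟩, rfl⟩ := (dartEquiv Q hE hk).surjective x
    obtain rfl : i = j := (faceConnected_iff M hsmall _ _).1 he
    refine ⟨d, ?_⟩
    rw [← hμ, ← hμ']
    rfl
  have hmem : ∀ v, μ v ∈ (M.emb.kBlock k (dartEquiv Q hE hk ⟨i, x₀⟩).toEdge).verts := fun v =>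
    ⟨_, hconn (r v), Sym2.mem_mk_left _ _⟩
  have hsurj : Function.Surjective fun v =>
      (⟨μ v, hmem v⟩ : (M.emb.kBlock k (dartEquiv Q hE hk ⟨i, x₀⟩).toEdge).verts) := by
    rintro ⟨w, e, he, hw⟩
    obtain ⟨d, hd⟩ := hconn' e he
    rw [hd] at hw
    rcases Sym2.mem_iff.1 hw with h | h
    exacts [⟨d.fst, Subtype.ext h.symm⟩, ⟨d.snd, Subtype.ext h.symm⟩]
  refine ⟨Equiv.ofBijective _ ⟨fun v w hvw => hinj (Subtype.ext_iff.1 hvw), hsurj⟩, ?_⟩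
  intro v w
  constructor
  · rintro ⟨e, he, hvw⟩
    obtain ⟨d, hd⟩ := hconn' e he
    rw [hd] at hvw
    rcases Sym2.eq_iff.1 hvw with ⟨h1, h2⟩ | ⟨h1, h2⟩
    · rw [← hinj h1, ← hinj h2]
      exact d.adj
    · rw [← hinj h1, ← hinj h2]
      exact d.adj.symm
  · intro h
    refine ⟨_, hconn ⟨(v, w), h⟩, ?_⟩
    change s(Q.q ⟨i, ⟨(v, w), h⟩⟩, Q.q (flip ⟨i, ⟨(v, w), h⟩⟩)) = s(μ v, μ w)
    rw [hμ, hμ']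

end BlockGluing

/-! ### The two bounds combined. -/

theorem exists_memBlockFamily {t k : ℕ} (ht : 1 ≤ t) (hk : 3 ≤ k) {V : Fin t → Type*}
    [∀ i, Fintype (V i)] (B : ∀ i, SimpleGraph (V i)) (hB : ∀ i, IsTrivialKBlock k (B i))
    (hfree : ∀ i, (SimpleGraph.cycleGraph k).Free (B i)) :
    ∃ (n : ℕ) (G : SimpleGraph (Fin n)), MemBlockFamily G k t B ∧
      n + (t - 1 + (t - 1) / k) = ∑ i, Fintype.card (V i) := by
  choose E hsmall hE using fun i => (hB i).exists_embedding
  have hE : BlockGluing.OuterSimple E := hE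
  have ha : ∀ i, ∃ d : BlockGluing.SDart B, d.1 = i ∧ d ∈ BlockGluing.Out E := by
    intro i
    obtain ⟨v⟩ := (E i).connected.nonempty
    obtain ⟨d, hd, -⟩ := (E i).exists_outer_dart v
    exact ⟨⟨i, d⟩, rfl, hd⟩
  choose a ha ha' using ha
  -- Here s = (t - 1) / k, the largest number of rings with s * k ≤ t - 1. The last argument says
  -- that the two ends of an outer edge of a block are distinct.
  obtain ⟨R⟩ := exists_ringGluing (β := fun d : BlockGluing.SDart B => d.1)
    (Out := BlockGluing.Out E) (φ₀ := BlockGluing.face₀ E) ht hk (Nat.div_mul_le_self (t - 1) k)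
    (fun d => rfl) BlockGluing.face₀_mem_out a ha ha' fun i h =>
      BlockGluing.pt_flip_ne (a i) (by rw [← BlockGluing.pt_face₀ (E := E), h])
  obtain ⟨n, q, hq, hq'⟩ := (BlockGluing.rot R).exists_sameCycle_quotient
  let Q : BlockGluing.VertexLabelling R n := ⟨q, hq, hq'⟩
  have hk2 : 2 ≤ k := by omega
  let d₀ := a ⟨0, ht⟩
  obtain ⟨E', h1, h2⟩ := BlockGluing.exists_embedding (Q := Q) hE hk2 d₀
  let M : BlockGluing.GluedEmbedding Q hE hk2 := ⟨E', h1, h2⟩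
  obtain ⟨f, hf⟩ := BlockGluing.exists_blocks_equiv M hsmall
  refine ⟨n, BlockGluing.graph Q hE (by omega),
    ⟨BlockGluing.graph_connected hE hk2 d₀, BlockGluing.graph_free hE hk hfree, E', f, ?_⟩,
    BlockGluing.card_eq Q hE (by omega) d₀⟩
  intro i
  have := BlockGluing.nonempty_iso_kBlock M hsmall (a i)
  rw [← hf (a i), ha i] at this
  exact this

theorem sum_card_le_of_memBlockFamily {t k : ℕ} (hk : 3 ≤ k) {V : Fin t → Type*}
    [∀ i, Fintype (V i)] {B : ∀ i, SimpleGraph (V i)} {W : Type*} [Fintype W] {G : SimpleGraph W}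
    (hG : MemBlockFamily G k t B) :
    (∑ i, Fintype.card (V i)) + 1 ≤ Fintype.card W + t + (t - 1) / k := by
  obtain ⟨-, hfree, E, f, hf⟩ := hG
  refine le_trans (le_of_eq ?_) (OuterplaneEmbedding.sum_card_verts_le hk hfree f)
  congr 1
  refine Finset.sum_congr rfl fun i _ => ?_
  rw [← Nat.card_eq_fintype_card]
  exact Nat.card_congr (hf i).some.toEquiv

theorem mainTheorem5 (t k : ℕ) (ht : 1 ≤ t) (hk : 3 ≤ k)
    (V : Fin t → Type*) [∀ i, Fintype (V i)] (B : ∀ i, SimpleGraph (V i))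
    (hB : ∀ i, IsTrivialKBlock k (B i))
    (hfree : ∀ i, (SimpleGraph.cycleGraph k).Free (B i)) :
    IsLeast
      {m : ℤ | ∃ (W : Type) (_ : Fintype W) (G : SimpleGraph W),
        MemBlockFamily G k t B ∧ m = Fintype.card W}
      ((∑ i, (Fintype.card (V i) : ℤ)) - ⌊((t : ℚ) - 1) / k⌋ - t + 1) := by
  have hfloor : ⌊((t : ℚ) - 1) / k⌋ = (((t - 1) / k : ℕ) : ℤ) := by
    rw [Int.natCast_ediv, ← Rat.floor_natCast_div_natCast, Nat.cast_sub ht, Nat.cast_one]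
  rw [hfloor]
  constructor
  · obtain ⟨n, G, hG, hn⟩ := exists_memBlockFamily ht hk B hB hfree
    refine ⟨Fin n, inferInstance, G, hG, ?_⟩
    rw [Fintype.card_fin]
    have hn' : ((n + (t - 1 + (t - 1) / k) : ℕ) : ℤ) = ∑ i, (Fintype.card (V i) : ℤ) := by
      rw [hn, Nat.cast_sum]
    omega
  · rintro _ ⟨W, _, G, hG, rfl⟩
    have h := sum_card_le_of_memBlockFamily hk hG
    have h' : ((∑ i, Fintype.card (V i) : ℕ) : ℤ) = ∑ i, (Fintype.card (V i) : ℤ) :=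
      Nat.cast_sum _ _
    omega
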